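/- Work on $\mathbb{R}^{1+3}$ with frequency variables $(\tau,\xi)\in\mathbb{R}\times\mathbb{R}^3$, write $\hat u$ for the space-time Fourier transform, $\langle x\rangle=(1+|x|^2)^{1/2}$, $D^{\sigma}$ for the Fourier multiplier with symbol $|\xi|^{\sigma}$, and $\frac1r+\frac1{r'}=1$. Let $H^r_{s,b}$ and $X^r_{s,b,\pm}$ be the completions of the Schwartz space $\mathcal S(\mathbb R^{1+3})$ for the norms $$\|u\|_{H^r_{s,b}}=\|\langle\xi\rangle^s\langle|\tau|-|\xi|\rangle^b\hat u\|_{L^{r'}_{\tau\xi}},\qquad \|u\|_{X^r_{s,b,\pm}}=\|\langle\xi\rangle^s\langle\tau\pm|\xi|\rangle^b\hat u\|_{L^{r'}_{\tau\xi}} .$$ For $i,j\in\{1,2,3\}$ let $q_{ij}(u,v)=Q_{ij}(D^{-1}u,D^{-1}v)$, $q_{0j}(u,v)=Q_{0j}(D^{-1}u,D^{-1}v)$ and $q_0(u,v)=Q_0(D^{-1}u,D^{-1}v)$, where $$Q_{\mu\nu}(f,g)=\partial_\mu f\,\partial_\nu g-\partial_\nu f\,\partial_\mu g,\qquad Q_0(f,g)=-\partial_tf\,\partial_tg+\sum_{i=1}^3\partial_if\,\partial_ig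 ,$$ and where, in $q_{0j}$ and $q_0$, the time derivative of a factor taken from $X^r_{\alpha,b,\pm}$ is the one that half-waves of that sign have, $\partial_t=\mp iD$ (that is, the time frequency in the symbol is $\mp|\xi|$, its value on the cone $\tau\pm|\xi|=0$). Let $1<r\le2$, $\alpha_1,\alpha_2\ge0$, $\alpha_1+\alpha_2\ge\frac2r$ and $b>\frac1r$. Then there is a constant $C$, depending only on $r,\alpha_1,\alpha_2,b$, such that for all choices of the signs $\pm_1,\pm_2$, all $i,j\in\{1,2,3\}$ and every $q\in\{q_{ij},\,q_{0j},\,q_0\}$, $$\|q(u,v)\|_{H^r_{0,0}}\le C\,\|u\|_{X^r_{\alpha_1,b,\pm_1}}\|v\|_{X^r_{\alpha_2,b,\pm_2}} .$$ This holds for all Schwartz functions $u,v$, for which $q(u,v)$ is an integrable function and $\widehat{q(u,v)}$ is $(2\pi)^{-4}$ times the convolution of $\hat u$ and $\hat v$ weighted by the symbol of $q$ (with $\hat u(p)=\int e^{-i\langle x,p\rangle}u(x)\,dx$). It also holds for all $u\in X^r_{\alpha_1,b,\pm_1}$, $v\in X^r_{\alpha_2,b,\pm_2}$ (given by measurable $\hat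 u$, $\hat v$ with finite norms), where $\widehat{q(u,v)}$ is defined by the same weighted convolution, which converges absolutely almost everywhere. -/

import Mathlib

open MeasureTheory
open scoped FourierTransform SchwartzMap ENNReal NNReal

noncomputable section

/-- Space-time `ℝ^{1+3}` (and its dual): coordinate `0` is time, coordinates `1, 2, 3` are space.
A point of the frequency side is written `p = (τ, ξ)`. -/
abbrev Spacetime := EuclideanSpace ℝ (Fin 4)

/-- The spatial part `ξ` of `p = (τ, ξ)`. -/
def spatial (p : Spacetime) : EuclideanSpace ℝ (Fin 3) :=
  WithLp.toLp 2 (fun j : Fin 3 => p j.succ)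

/-- A sign as a real number, `1` or `-1`. -/
def sgn (ε : ℤˣ) : ℝ := ((ε : ℤ) : ℝ)

/-- The Japanese bracket `⟨x⟩ = (1 + |x|²)^{1/2}`. -/
def japanese (x : ℝ) : ℝ := Real.sqrt (1 + x ^ 2)

/-- The space-time Fourier transform `û(p) = ∫ e^{-i⟨x, p⟩} u(x) dx` in angular frequencies;
Mathlib's `𝓕` has the kernel `e^{-2πi⟨x, k⟩}`. -/
def angularFourier (u : Spacetime → ℂ) (p : Spacetime) : ℂ :=
  𝓕 u ((2 * Real.pi)⁻¹ • p)

/-- The Fourier multiplier with symbol `m` (a function of the angular frequency `p = 2πk`). -/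
def fourierMultiplier (m : Spacetime → ℂ) (u : Spacetime → ℂ) : Spacetime → ℂ :=
  𝓕⁻ (fun k : Spacetime => m ((2 * Real.pi) • k) * 𝓕 u k)

/-- The dual exponent `r'`, `1/r + 1/r' = 1`. -/
def dualExponent (r : ℝ) : ℝ≥0∞ := ENNReal.ofReal (r / (r - 1))

/-- `‖⟨ξ⟩^s ⟨|τ| - |ξ|⟩^b F‖_{L^{r'}}`, the `H^r_{s,b}` norm of the `u` with `û = F`. -/
def hNormHat (r s b : ℝ) (F : Spacetime → ℂ) : ℝ≥0∞ :=
  eLpNorm (fun p => ((japanese ‖spatial p‖ ^ s *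
    japanese (|p 0| - ‖spatial p‖) ^ b : ℝ) : ℂ) * F p) (dualExponent r) volume

/-- `‖⟨ξ⟩^s ⟨τ ± |ξ|⟩^b F‖_{L^{r'}}`, the `X^r_{s,b,±}` norm of the `u` with `û = F`. -/
def xNormHat (r s b : ℝ) (ε : ℤˣ) (F : Spacetime → ℂ) : ℝ≥0∞ :=
  eLpNorm (fun p => ((japanese ‖spatial p‖ ^ s *
    japanese (p 0 + sgn ε * ‖spatial p‖) ^ b : ℝ) : ℂ) * F p) (dualExponent r) volume

/-- The `H^r_{s,b}` norm of a function of space-time. -/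
def hNorm (r s b : ℝ) (u : Spacetime → ℂ) : ℝ≥0∞ := hNormHat r s b (angularFourier u)

/-- The `X^r_{s,b,±}` norm of a function of space-time. -/
def xNorm (r s b : ℝ) (ε : ℤˣ) (u : Spacetime → ℂ) : ℝ≥0∞ := xNormHat r s b ε (angularFourier u)

/-- `D⁻¹`, the multiplier with symbol `|ξ|⁻¹`. -/
def invD (u : Spacetime → ℂ) : Spacetime → ℂ :=
  fourierMultiplier (fun p => ((‖spatial p‖⁻¹ : ℝ) : ℂ)) u

/-- The space-time gradient: `grad f μ = ∂_μ f`. -/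
def grad (f : Spacetime → ℂ) (μ : Fin 4) (x : Spacetime) : ℂ :=
  lineDeriv ℝ f x (EuclideanSpace.single μ (1 : ℝ))

/-- `a_μ b_ν - a_ν b_μ` for two gradient fields. -/
def wedgeForm (μ ν : Fin 4) (a b : Fin 4 → Spacetime → ℂ) (x : Spacetime) : ℂ :=
  a μ x * b ν x - a ν x * b μ x

/-- `a_α b^α = -a_0 b_0 + ∑_i a_i b_i` for two gradient fields (metric `diag(-1,1,1,1)`). -/
def minkowskiForm (a b : Fin 4 → Spacetime → ℂ) (x : Spacetime) : ℂ :=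
  -(a 0 x * b 0 x) + ∑ i : Fin 3, a i.succ x * b i.succ x

/-- `q_{ij}(u, v) = Q_{ij}(D⁻¹u, D⁻¹v)`, where `Q_{ij}(f, g) = ∂_i f ∂_j g - ∂_j f ∂_i g`. -/
def qij (i j : Fin 3) (u v : Spacetime → ℂ) : Spacetime → ℂ :=
  wedgeForm i.succ j.succ (grad (invD u)) (grad (invD v))

/-- The frequency `(∓|ξ|, ξ)` on the cone `τ ± |ξ| = 0` on which the weight of `X^r_{s,b,±}` is
concentrated. -/
def coneFreq (ε : ℤˣ) (p : Spacetime) : Fin 4 → ℝ :=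
  Fin.cons (-(sgn ε * ‖spatial p‖)) (fun j : Fin 3 => spatial p j)

/-- The gradient of `D⁻¹u` for a half-wave `u` of sign `±`: the spatial derivatives are the true
ones, and the time derivative is the one that half-waves have, `∂_t = ∓iD`, that is, the
multiplier with symbol `i τ / |ξ|` at `τ = ∓|ξ|`. -/
def halfWaveGrad (ε : ℤˣ) (u : Spacetime → ℂ) : Fin 4 → Spacetime → ℂ :=
  Fin.cons
    (fourierMultiplier
      (fun p => Complex.I * ((coneFreq ε p 0 : ℝ) : ℂ) * ((‖spatial p‖⁻¹ : ℝ) : ℂ)) u)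
    (fun j : Fin 3 => grad (invD u) j.succ)

/-- `q_{0j}(u, v) = Q_{0j}(D⁻¹u, D⁻¹v)` for half-waves `u`, `v` of signs `ε₁`, `ε₂`, where
`Q_{0j}(f, g) = ∂_t f ∂_j g - ∂_j f ∂_t g`. -/
def q0j (ε₁ ε₂ : ℤˣ) (j : Fin 3) (u v : Spacetime → ℂ) : Spacetime → ℂ :=
  wedgeForm 0 j.succ (halfWaveGrad ε₁ u) (halfWaveGrad ε₂ v)

/-- `q_0(u, v) = Q_0(D⁻¹u, D⁻¹v)` for half-waves `u`, `v` of signs `ε₁`, `ε₂`, where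
`Q_0(f, g) = -∂_t f ∂_t g + ∑_i ∂_i f ∂_i g`. -/
def q0 (ε₁ ε₂ : ℤˣ) (u v : Spacetime → ℂ) : Spacetime → ℂ :=
  minkowskiForm (halfWaveGrad ε₁ u) (halfWaveGrad ε₂ v)

/-- The symbol of the bilinear operator `q_{ij}`. -/
def symbolQij (i j : Fin 3) (p p' : Spacetime) : ℝ :=
  -(spatial p i * spatial p' j - spatial p j * spatial p' i) / (‖spatial p‖ * ‖spatial p'‖)

/-- The symbol of the bilinear operator `q_{0j}` on half-waves. -/
def symbolQ0j (ε₁ ε₂ : ℤˣ) (j : Fin 3) (p p' : Spacetime) : ℝ :=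
  -(coneFreq ε₁ p 0 * spatial p' j - spatial p j * coneFreq ε₂ p' 0) /
    (‖spatial p‖ * ‖spatial p'‖)

/-- The symbol of the bilinear operator `q_0` on half-waves. -/
def symbolQ0 (ε₁ ε₂ : ℤˣ) (p p' : Spacetime) : ℝ :=
  -(-(coneFreq ε₁ p 0 * coneFreq ε₂ p' 0) + ∑ i : Fin 3, spatial p i * spatial p' i) /
    (‖spatial p‖ * ‖spatial p'‖)

/-- The integrand `p' ↦ σ(p', p - p') f(p') g(p - p')` of a bilinear Fourier multiplier. -/
def bilinearIntegrand (σ : Spacetime → Spacetime → ℝ) (f g : Spacetime → ℂ)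
    (p p' : Spacetime) : ℂ :=
  ((σ p' (p - p') : ℝ) : ℂ) * f p' * g (p - p')

/-- The bilinear Fourier multiplier with symbol `σ`, on the Fourier side: if `û = f`, `v̂ = g`, this
is the Fourier transform of the image of `(u, v)`. -/
def bilinearHat (σ : Spacetime → Spacetime → ℝ) (f g : Spacetime → ℂ) (p : Spacetime) : ℂ :=
  (((2 * Real.pi) ^ 4 : ℝ) : ℂ)⁻¹ * ∫ p' : Spacetime, bilinearIntegrand σ f g p p'

/-- `‖q(u, v)‖_{H^r_{0,0}} ≤ C ‖u‖_{X^r_{α₁,b,ε₁}} ‖v‖_{X^r_{α₂,b,ε₂}}` for the bilinear operator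
`q` with symbol `σ`.
* On Schwartz functions, `q(u, v)` is an integrable function, which satisfies the bound, and whose
  Fourier transform is given by `σ`.
* On the whole spaces (the completions of the Schwartz space), whose elements are given by their
  Fourier transforms `f`, `g`, the operator extends through `σ`: the integral
  converges absolutely almost everywhere and satisfies the bound. -/
def NullFormEstimate (r α₁ α₂ b : ℝ) (ε₁ ε₂ : ℤˣ) (C : ℝ≥0)
    (q : (Spacetime → ℂ) → (Spacetime → ℂ) → Spacetime → ℂ)
    (σ : Spacetime → Spacetime → ℝ) : Prop :=
  (∀ u v : 𝓢(Spacetime, ℂ),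
    Integrable (q u v) volume ∧
    hNorm r 0 0 (q u v) ≤ C * xNorm r α₁ b ε₁ u * xNorm r α₂ b ε₂ v ∧
    angularFourier (q u v) =ᵐ[volume] bilinearHat σ (angularFourier u) (angularFourier v)) ∧
  (∀ f g : Spacetime → ℂ,
    AEStronglyMeasurable f volume → AEStronglyMeasurable g volume →
    xNormHat r α₁ b ε₁ f < ∞ → xNormHat r α₂ b ε₂ g < ∞ →
    (∀ᵐ p ∂(volume : Measure Spacetime), Integrable (bilinearIntegrand σ f g p) volume) ∧
    hNormHat r 0 0 (bilinearHat σ f g) ≤ C * xNormHat r α₁ b ε₁ f * xNormHat r α₂ b ε₂ g)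

end

/-! On the Fourier side `q` is a convolution weighted by its symbol `σ`. Dividing `σ` by the weights
of the two spaces and applying Hölder in the convolution variable `p'`, with exponents `r` and `r'`,
leaves the convolution of two `r'`-th powers, whose integral is a product by Tonelli. So it suffices
to bound `∫ |σ / (weights)|^r dp'` uniformly in `p` (`lintegral_weightedSymbol_le`).

Write `ρ = |η|`, `s = |ξ - η|`, `R = |ξ|`, and let `e` be the product of the two signs. Three facts
enter. Every null symbol satisfies `σ² ≤ D / (ρ s)`, where `D = (ρ + s)² - R²` if `e = 1` and `D =
R² - (ρ - s)²` if `e = -1`, so it is small at parallel frequencies (`NullSymbol`). The condition on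
`α₁ + α₂` makes the `r`-th power of the spatial weights at least `min(ρ, s)²`. Since `r b > 1`, the
function `⟨t⟩^{-r b}` is integrable; integrating out the time frequency therefore reduces the claim
to bounding, uniformly in the level, the kernel integrated over the ellipsoids or hyperboloids on
which `s + e ρ` is constant (`lintegral_bipolarKernel_le`).

In bipolar coordinates `dη = (2π / R) ρ s dρ ds`. If `ρ ≤ s`, `l = s + e ρ` and `d = |l - R|`, the
resulting density is dominated by `d⁻¹ (d / ρ)^r` on `ρ > d / 2` plus `R⁻¹` on an interval of length
`R` (`nullDefect_kernel_le`). Both have `ρ`-integrals independent of `l` and `R`; the first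
converges because `r > 1`.

For Schwartz functions it remains to identify the Fourier transform of `q(u, v)` with the weighted
convolution. The multipliers involved are bounded but discontinuous at `ξ = 0`, so this is done in
`L¹ ∩ L²` and almost everywhere. -/

noncomputable section

/-! ### Fourier inversion, products and derivatives for integrable functions -/

section FourierGeneral

variable {E : Type*} [NormedAddCommGroup E] [InnerProductSpace ℝ E] [FiniteDimensional ℝ E]
  [MeasurableSpace E] [BorelSpace E]

omit [FiniteDimensional ℝ E] [MeasurableSpace E] [BorelSpace E] in
lemma continuous_neg_inner :
    Continuous fun p : E × E => (-innerₗ E : E →ₗ[ℝ] E →ₗ[ℝ] ℝ) p.1 p.2 := by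
  change Continuous fun p : E × E => -inner ℝ p.1 p.2
  fun_prop

lemma integral_fourierInv_mul_eq_flip {f g : E → ℂ} (hf : Integrable f) (hg : Integrable g) :
    ∫ x, 𝓕⁻ f x * g x = ∫ x, f x * 𝓕⁻ g x := by
  have h := VectorFourier.integral_fourierIntegral_smul_eq_flip (μ := volume) (ν := volume)
    (L := -innerₗ E) Real.continuous_fourierChar
    continuous_neg_inner hf hg
  have e : (-innerₗ E).flip = -innerₗ E := by
    ext x y; simp [real_inner_comm]
  rw [e] at h
  exact h

lemma integral_fourier_mul_eq_flip {f g : E → ℂ} (hf : Integrable f) (hg : Integrable g) :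
    ∫ x, 𝓕 f x * g x = ∫ x, f x * 𝓕 g x := by
  have h := VectorFourier.integral_fourierIntegral_smul_eq_flip (μ := volume) (ν := volume)
    (L := innerₗ E) Real.continuous_fourierChar
    (by simpa using continuous_inner (𝕜 := ℝ) (E := E)) hf hg
  rw [flip_innerₗ] at h
  exact h

/-- Locally integrable functions with the same integrals against Schwartz functions agree. -/
lemma ae_eq_of_forall_schwartz {f g : E → ℂ} (hf : LocallyIntegrable f) (hg : LocallyIntegrable g)
    (h : ∀ φ : 𝓢(E, ℂ), ∫ x, φ x * f x = ∫ x, φ x * g x) : f =ᵐ[volume] g := by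
  refine ae_eq_of_integral_contDiff_smul_eq hf hg fun φ hφ hc => ?_
  have hc' : HasCompactSupport (fun x => (φ x : ℂ)) := hc.comp_left (g := fun t : ℝ => (t : ℂ)) (by simp)
  have hφ' : ContDiff ℝ (⊤ : ℕ∞) (fun x => (φ x : ℂ)) := Complex.ofRealCLM.contDiff.comp hφ
  simpa using h (hc'.toSchwartzMap hφ')

lemma continuous_fourierInv {f : E → ℂ} (hf : Integrable f) : Continuous (𝓕⁻ f) :=
  VectorFourier.fourierIntegral_continuous Real.continuous_fourierChar
    continuous_neg_inner hf

lemma continuous_fourier {f : E → ℂ} (hf : Integrable f) : Continuous (𝓕 f) :=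
  VectorFourier.fourierIntegral_continuous Real.continuous_fourierChar
    (by simpa using continuous_inner (𝕜 := ℝ) (E := E)) hf

/-- Fourier inversion almost everywhere, without continuity. -/
lemma fourier_fourierInv_ae_eq {f : E → ℂ} (hf : Integrable f) (hf' : Integrable (𝓕⁻ f)) :
    𝓕 (𝓕⁻ f) =ᵐ[volume] f := by
  refine ae_eq_of_forall_schwartz (continuous_fourier hf').locallyIntegrable
    hf.locallyIntegrable fun φ => ?_
  -- Both transforms are moved onto the test function, where inversion holds pointwise.
  have h1 := integral_fourier_mul_eq_flip φ.integrable hf'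
  have h2 := integral_fourierInv_mul_eq_flip (𝓕 φ).integrable hf
  rw [← h1, SchwartzMap.fourier_coe] at *
  rw [← h2, ← SchwartzMap.fourier_coe, ← SchwartzMap.fourierInv_coe]
  simp

/-- The inverse Fourier integral of a function in `L¹ ∩ L²` is in `L²`. -/
lemma memLp_two_fourierInv {f : E → ℂ} (hf : Integrable f) (hf2 : MemLp f 2) :
    MemLp (𝓕⁻ f) 2 := by
  set F : Lp (α := E) ℂ 2 volume := hf2.toLp f with hF
  -- The inverse integral and the `L²` inverse transform define the same tempered distribution; the
  -- latter is in `L²` by Plancherel.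
  have key : 𝓕⁻ f =ᵐ[volume] (𝓕⁻ F : Lp (α := E) ℂ 2 volume) := by
    refine ae_eq_of_forall_schwartz (continuous_fourierInv hf).locallyIntegrable
      ((Lp.memLp (𝓕⁻ F : Lp (α := E) ℂ 2 volume)).locallyIntegrable (by norm_num)) fun φ => ?_
    have h := congrArg (fun T : 𝓢'(E, ℂ) => T φ) (Lp.fourierInv_toTemperedDistribution_eq F)
    simp only [Lp.toTemperedDistribution_apply, smul_eq_mul] at h
    rw [← h]
    change _ = Lp.toTemperedDistribution F (𝓕⁻ φ)
    rw [Lp.toTemperedDistribution_apply, ← integral_fourierInv_mul_eq_flip φ.integrable hf,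
      SchwartzMap.fourierInv_coe]
    refine integral_congr_ae ?_
    filter_upwards [hf2.coeFn_toLp] with x hx
    simp [hx, hF]
  exact (memLp_congr_ae key).2 (Lp.memLp _)

/-- The Fourier transform of a product of inverse Fourier integrals is the convolution. -/
lemma fourier_mul_fourierInv_ae_eq {f g : E → ℂ} (hf : Integrable f) (hf2 : MemLp f 2)
    (hg : Integrable g) (hg2 : MemLp g 2) :
    𝓕 (fun x => 𝓕⁻ f x * 𝓕⁻ g x) =ᵐ[volume] fun k => ∫ k', f k' * g (k - k') := by
  have hprod : Integrable (fun x => 𝓕⁻ f x * 𝓕⁻ g x) :=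
    (memLp_two_fourierInv hf hf2).integrable_mul (memLp_two_fourierInv hg hg2)
  set h : E → ℂ := fun k => ∫ k', f k' * g (k - k') with hh
  have hconv : h = convolution f g (ContinuousLinearMap.mul ℂ ℂ) volume := rfl
  have hint : Integrable h := by
    rw [hconv]; exact hf.integrable_convolution _ hg
  have heq : 𝓕⁻ h = fun x => 𝓕⁻ f x * 𝓕⁻ g x := by
    ext x
    simp only [Real.fourierInv_eq_fourier_neg]
    rw [hconv, Real.fourier_mul_convolution_eq hf hg]
  rw [← heq] at hprod ⊢
  exact fourier_fourierInv_ae_eq hint hprod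

/-- Directional derivatives of an inverse Fourier integral. -/
lemma lineDeriv_fourierInv {f : E → ℂ} (hf : Integrable f)
    (hf' : Integrable (fun v => ‖v‖ * ‖f v‖)) (x w : E) :
    lineDeriv ℝ (𝓕⁻ f) x w
      = 𝓕⁻ (fun v => (2 * Real.pi * Complex.I * (inner ℝ v w : ℝ)) * f v) x := by
  have h := VectorFourier.hasFDerivAt_fourierIntegral (-innerSL ℝ) hf hf' x
  have h2 : lineDeriv ℝ (𝓕⁻ f) x w = _ := (h.hasLineDerivAt w).lineDeriv
  rw [h2, Real.fourierIntegral_continuousLinearMap_apply' ]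
  · have : (fun v => VectorFourier.fourierSMulRight (-innerSL ℝ (E := E)) f v w) =
      (fun v => (2 * Real.pi * Complex.I * (inner ℝ v w : ℝ)) * f v) := by
      ext v
      rw [VectorFourier.fourierSMulRight_apply,
        show (-innerSL ℝ (E := E)) v w = -inner ℝ v w from rfl, smul_eq_mul, Complex.real_smul]
      push_cast
      ring
    rw [this]; rfl
  · refine (hf'.norm.const_mul (2 * Real.pi * ‖-innerSL ℝ (E := E)‖)).mono' ?_ ?_
    · exact hf.1.fourierSMulRight
    · refine Filter.Eventually.of_forall fun v => ?_
      refine (VectorFourier.norm_fourierSMulRight_le _ f v).trans_eq ?_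
      simp; ring

end FourierGeneral

/-! ### Time and space variables; integrability of `|ξ|⁻¹` times a Schwartz function -/

lemma spatial_apply (p : Spacetime) (j : Fin 3) : spatial p j = p j.succ := rfl

lemma spatial_smul (c : ℝ) (p : Spacetime) : spatial (c • p) = c • spatial p := by
  ext j; simp [spatial_apply]

lemma spatial_sub (p q : Spacetime) : spatial (p - q) = spatial p - spatial q := by
  ext j; simp [spatial_apply]

lemma continuous_spatial : Continuous spatial := by
  unfold spatial
  fun_prop

lemma norm_sq_eq_spatial (p : Spacetime) : ‖p‖ ^ 2 = p 0 ^ 2 + ‖spatial p‖ ^ 2 := by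
  simp [EuclideanSpace.norm_sq_eq, Fin.sum_univ_succ, spatial_apply]

lemma measurePreserving_time_spatial :
    MeasurePreserving (fun p : Spacetime => (p 0, spatial p)) volume (volume.prod volume) := by
  have h1 := PiLp.volume_preserving_ofLp (Fin 4)
  have h2 := volume_preserving_piFinSuccAbove (fun _ : Fin 4 => ℝ) 0
  have h3 := (MeasurePreserving.id (volume : Measure ℝ)).prod (PiLp.volume_preserving_toLp (Fin 3))
  exact h3.comp (h2.comp h1)

lemma ae_spatial_ne_zero : ∀ᵐ p : Spacetime, spatial p ≠ 0 := by
  have h : ∀ᵐ q : ℝ × EuclideanSpace ℝ (Fin 3) ∂(volume.prod volume), q.2 ≠ 0 :=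
    Measure.quasiMeasurePreserving_snd.ae (Measure.ae_ne volume 0)
  exact measurePreserving_time_spatial.quasiMeasurePreserving.ae h

/-- The singularity is harmless in three dimensions: the radial Jacobian `y²` absorbs `y⁻¹`. -/
lemma integrable_inv_norm_mul_decay :
    Integrable (fun p : Spacetime =>
      (1 + p 0 ^ 2)⁻¹ * (‖spatial p‖⁻¹ * ((1 + ‖spatial p‖ ^ 2) ^ 2)⁻¹)) := by
  have h1 : Integrable (fun ξ : EuclideanSpace ℝ (Fin 3) => ‖ξ‖⁻¹ * ((1 + ‖ξ‖ ^ 2) ^ 2)⁻¹) := by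
    rw [integrable_fun_norm_addHaar volume (f := fun y : ℝ => y⁻¹ * ((1 + y ^ 2) ^ 2)⁻¹)]
    refine (integrable_inv_one_add_sq.integrableOn (s := Set.Ioi 0)).mono'
      (by fun_prop) ((ae_restrict_iff' measurableSet_Ioi).2 (Filter.Eventually.of_forall ?_))
    intro y hy
    have hy : 0 < y := hy
    simp only [finrank_euclideanSpace, Fintype.card_fin, smul_eq_mul]
    rw [Real.norm_of_nonneg (by positivity)]
    have : y ^ (3 - 1) * (y⁻¹ * ((1 + y ^ 2) ^ 2)⁻¹) = (1 + y ^ 2)⁻¹ * (y / (1 + y ^ 2)) := by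
      field_simp
    rw [this]
    refine mul_le_of_le_one_right (by positivity) ?_
    rw [div_le_one (by positivity)]
    nlinarith [sq_nonneg (y - 1)]
  have h2 := integrable_inv_one_add_sq.mul_prod h1
  exact measurePreserving_time_spatial.integrable_comp_of_integrable h2

lemma schwartz_decay (φ : 𝓢(Spacetime, ℂ)) : ∃ C : ℝ, 0 ≤ C ∧ ∀ k,
    (1 + ‖k‖) * ‖φ k‖ ≤ C * ((1 + k 0 ^ 2)⁻¹ * ((1 + ‖spatial k‖ ^ 2) ^ 2)⁻¹) := by
  -- The exponent is `7 = 1 + 2 + 4`: one power for the factor `1 + ‖k‖`, two for `1 + τ²` and four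
  -- for `(1 + |ξ|²)²`.
  have h := SchwartzMap.one_add_le_sup_seminorm_apply (𝕜 := ℝ) (m := (7, 0)) (k := 7) (n := 0)
    le_rfl le_rfl φ
  set C := 2 ^ (7, 0).1 * ((Finset.Iic (7, 0)).sup fun m => SchwartzMap.seminorm ℝ m.1 m.2) φ
  refine ⟨C, le_trans (by positivity) (h 0), fun k => ?_⟩
  have hk := h k
  rw [norm_iteratedFDeriv_zero] at hk
  rw [← mul_inv, ← div_eq_mul_inv, le_div_iff₀ (by positivity)]
  refine le_trans ?_ hk
  have h1 : 1 + k 0 ^ 2 ≤ (1 + ‖k‖) ^ 2 := by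
    nlinarith [norm_sq_eq_spatial k, norm_nonneg k, sq_nonneg ‖spatial k‖]
  have h2 : 1 + ‖spatial k‖ ^ 2 ≤ (1 + ‖k‖) ^ 2 := by
    nlinarith [norm_sq_eq_spatial k, norm_nonneg k, sq_nonneg (k 0)]
  calc (1 + ‖k‖) * ‖φ k‖ * ((1 + k 0 ^ 2) * (1 + ‖spatial k‖ ^ 2) ^ 2)
      ≤ (1 + ‖k‖) * ‖φ k‖ * ((1 + ‖k‖) ^ 2 * ((1 + ‖k‖) ^ 2) ^ 2) := by gcongr
    _ = _ := by ring

lemma measurable_spatial_norm_inv (c : ℝ) :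
    Measurable (fun k : Spacetime => ((‖spatial (c • k)‖⁻¹ : ℝ) : ℂ)) := by
  have := continuous_spatial
  have h : Continuous fun k : Spacetime => ‖spatial (c • k)‖ := by fun_prop
  exact Complex.measurable_ofReal.comp h.measurable.inv

/-- The two integrability conditions under which the Fourier integral of `D⁻¹u` may be
differentiated. -/
lemma integrable_inv_norm_mul_schwartz (φ : 𝓢(Spacetime, ℂ)) :
    Integrable (fun k : Spacetime => ((‖spatial ((2 * Real.pi) • k)‖⁻¹ : ℝ) : ℂ) * φ k) ∧
    Integrable (fun k : Spacetime =>
      ‖k‖ * ‖((‖spatial ((2 * Real.pi) • k)‖⁻¹ : ℝ) : ℂ) * φ k‖) := by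
  obtain ⟨C, hC, h⟩ := schwartz_decay φ
  have hm : AEStronglyMeasurable
      (fun k : Spacetime => ((‖spatial ((2 * Real.pi) • k)‖⁻¹ : ℝ) : ℂ) * φ k) :=
    ((measurable_spatial_norm_inv _).mul φ.continuous.measurable).aestronglyMeasurable
  have key : ∀ k : Spacetime, (1 + ‖k‖) *
      ‖((‖spatial ((2 * Real.pi) • k)‖⁻¹ : ℝ) : ℂ) * φ k‖ ≤ (2 * Real.pi)⁻¹ * C *
      ((1 + k 0 ^ 2)⁻¹ * (‖spatial k‖⁻¹ * ((1 + ‖spatial k‖ ^ 2) ^ 2)⁻¹)) := by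
    intro k
    have hk := mul_le_mul_of_nonneg_left (h k)
      (show 0 ≤ (2 * Real.pi)⁻¹ * ‖spatial k‖⁻¹ by positivity)
    have e : ‖((‖spatial ((2 * Real.pi) • k)‖⁻¹ : ℝ) : ℂ)‖ = (2 * Real.pi)⁻¹ * ‖spatial k‖⁻¹ := by
      rw [Complex.norm_real, norm_inv, norm_norm, spatial_smul, norm_smul,
        Real.norm_of_nonneg (by positivity), mul_inv]
    rw [norm_mul, e]
    calc _ = (2 * Real.pi)⁻¹ * ‖spatial k‖⁻¹ * ((1 + ‖k‖) * ‖φ k‖) := by ring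
      _ ≤ _ := hk
      _ = _ := by ring
  have hd := integrable_inv_norm_mul_decay.const_mul ((2 * Real.pi)⁻¹ * C)
  constructor
  · refine hd.mono' hm (Filter.Eventually.of_forall fun k => le_trans ?_ (key k))
    exact le_mul_of_one_le_left (norm_nonneg _) (by simp)
  · refine hd.mono' (continuous_norm.aestronglyMeasurable.mul hm.norm) (Filter.Eventually.of_forall fun k => le_trans ?_ (key k))
    rw [norm_mul, norm_norm, norm_norm]
    gcongr
    simp

/-! ### Null forms of Schwartz functions as weighted convolutions -/

/-- The symbol of the gradient of `D⁻¹` on half-waves. -/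
def gradSymbol (ε : ℤˣ) (μ : Fin 4) (p : Spacetime) : ℂ :=
  Complex.I * ((coneFreq ε p μ : ℝ) : ℂ) * ((‖spatial p‖⁻¹ : ℝ) : ℂ)

lemma abs_sgn (ε : ℤˣ) : |sgn ε| = 1 := by
  rcases Int.units_eq_one_or ε with h | h <;> simp [sgn, h]

lemma abs_coneFreq_le (ε : ℤˣ) (p : Spacetime) (μ : Fin 4) : |coneFreq ε p μ| ≤ ‖spatial p‖ := by
  refine Fin.cases ?_ (fun j => ?_) μ
  · simp [coneFreq, abs_mul, abs_sgn]
  · simpa [coneFreq] using PiLp.norm_apply_le (spatial p) j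

lemma norm_gradSymbol_le (ε : ℤˣ) (μ : Fin 4) (p : Spacetime) : ‖gradSymbol ε μ p‖ ≤ 1 := by
  rw [gradSymbol, norm_mul, norm_mul, Complex.norm_I, one_mul, Complex.norm_real, Complex.norm_real,
    norm_inv, norm_norm, ← div_eq_mul_inv]
  exact div_le_one_of_le₀ (abs_coneFreq_le ε p μ) (norm_nonneg _)

lemma measurable_coneFreq (ε : ℤˣ) (μ : Fin 4) : Measurable (fun p => coneFreq ε p μ) := by
  have := continuous_spatial
  refine Continuous.measurable ?_
  refine Fin.cases ?_ (fun j => ?_) μ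
  · simp only [coneFreq, Fin.cons_zero]
    fun_prop
  · simp only [coneFreq, Fin.cons_succ]
    fun_prop

lemma measurable_gradSymbol (ε : ℤˣ) (μ : Fin 4) : Measurable (gradSymbol ε μ) :=
  (measurable_const.mul (Complex.measurable_ofReal.comp (measurable_coneFreq ε μ))).mul
    (Complex.measurable_ofReal.comp continuous_spatial.norm.measurable.inv)

/-- Only the composite of `∂_μ` and `D⁻¹` has a bounded symbol. The time component is a multiplier
by definition; the spatial ones require differentiation under the integral. -/
lemma halfWaveGrad_eq_fourierMultiplier (ε : ℤˣ) (u : 𝓢(Spacetime, ℂ)) (μ : Fin 4) :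
    halfWaveGrad ε u μ = fourierMultiplier (gradSymbol ε μ) u := by
  refine Fin.cases rfl (fun j => ?_) μ
  funext x
  have h := integrable_inv_norm_mul_schwartz (𝓕 u)
  simp only [SchwartzMap.fourier_coe] at h
  simp only [halfWaveGrad, Fin.cons_succ, grad, invD, fourierMultiplier]
  rw [lineDeriv_fourierInv h.1 h.2]
  refine congrArg (fun f : Spacetime → ℂ => 𝓕⁻ f x) (funext fun v => ?_)
  simp only [gradSymbol, coneFreq, Fin.cons_succ]
  rw [show spatial ((2 * Real.pi) • v) j = 2 * Real.pi * v j.succ by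
    simp [spatial_apply]]
  rw [EuclideanSpace.inner_single_right]
  simp
  ring

lemma multiplier_mul_schwartz {m : Spacetime → ℂ} (hm : Measurable m) (hb : ∀ p, ‖m p‖ ≤ 1)
    (φ : 𝓢(Spacetime, ℂ)) :
    Integrable (fun k => m ((2 * Real.pi) • k) * φ k) ∧
      MemLp (fun k => m ((2 * Real.pi) • k) * φ k) 2 := by
  have hmeas : AEStronglyMeasurable (fun k : Spacetime => m ((2 * Real.pi) • k) * φ k) :=
    ((hm.comp (measurable_const_smul _)).mul φ.continuous.measurable).aestronglyMeasurable
  have hle : ∀ k : Spacetime, ‖m ((2 * Real.pi) • k) * φ k‖ ≤ ‖φ k‖ := fun k => by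
    rw [norm_mul]
    exact mul_le_of_le_one_left (norm_nonneg _) (hb _)
  exact ⟨φ.integrable.mono hmeas (Filter.Eventually.of_forall hle),
    (φ.memLp 2 volume).mono hmeas (Filter.Eventually.of_forall hle)⟩

/-- The transform of a product is a convolution in `k`; the substitution `p' = 2πk'` in four
dimensions produces the factor `(2π)⁻⁴`. -/
lemma angularFourier_mul_fourierMultiplier {m₁ m₂ : Spacetime → ℂ} (hm₁ : Measurable m₁)
    (hm₂ : Measurable m₂) (hb₁ : ∀ p, ‖m₁ p‖ ≤ 1) (hb₂ : ∀ p, ‖m₂ p‖ ≤ 1)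
    (u v : 𝓢(Spacetime, ℂ)) :
    Integrable (fun x => fourierMultiplier m₁ u x * fourierMultiplier m₂ v x) ∧
    (∀ p, Integrable fun p' =>
      (m₁ p' * angularFourier u p') * (m₂ (p - p') * angularFourier v (p - p'))) ∧
    angularFourier (fun x => fourierMultiplier m₁ u x * fourierMultiplier m₂ v x) =ᵐ[volume]
      fun p => (((2 * Real.pi) ^ 4 : ℝ) : ℂ)⁻¹ * ∫ p',
        (m₁ p' * angularFourier u p') * (m₂ (p - p') * angularFourier v (p - p')) := by
  obtain ⟨hf, hf2⟩ := multiplier_mul_schwartz hm₁ hb₁ (𝓕 u)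
  obtain ⟨hg, hg2⟩ := multiplier_mul_schwartz hm₂ hb₂ (𝓕 v)
  rw [SchwartzMap.fourier_coe] at hf hf2 hg hg2
  have hpi : (2 * Real.pi) ≠ 0 := by positivity
  have hcomm : ∀ p p' : Spacetime,
      (m₁ p' * angularFourier u p') * (m₂ (p - p') * angularFourier v (p - p')) =
      (fun k' => (m₁ ((2 * Real.pi) • k') * 𝓕 (⇑u) k') *
        (m₂ ((2 * Real.pi) • ((2 * Real.pi)⁻¹ • p - k')) * 𝓕 (⇑v) ((2 * Real.pi)⁻¹ • p - k')))
        ((2 * Real.pi)⁻¹ • p') := by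
    intro p p'
    simp only [angularFourier, ← smul_sub, smul_smul, mul_inv_cancel₀ hpi, one_smul]
  refine ⟨(memLp_two_fourierInv hf hf2).integrable_mul (memLp_two_fourierInv hg hg2), ?_, ?_⟩
  · intro p
    simp only [hcomm p]
    refine Integrable.comp_smul (μ := volume) (f := fun k' => (m₁ ((2 * Real.pi) • k') * 𝓕 (⇑u) k') *
        (m₂ ((2 * Real.pi) • ((2 * Real.pi)⁻¹ • p - k')) * 𝓕 (⇑v) ((2 * Real.pi)⁻¹ • p - k'))) ?_ (inv_ne_zero hpi)
    exact hf2.integrable_mul (hg2.comp_measurePreserving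
      (Measure.measurePreserving_sub_left volume ((2 * Real.pi)⁻¹ • p)))
  · have h := fourier_mul_fourierInv_ae_eq hf hf2 hg hg2
    have hq : Measure.QuasiMeasurePreserving (fun p : Spacetime => (2 * Real.pi)⁻¹ • p)
        volume volume := by
      refine ⟨measurable_const_smul _, ?_⟩
      rw [Measure.map_addHaar_smul volume (inv_ne_zero hpi)]
      exact Measure.smul_absolutelyContinuous
    filter_upwards [hq.ae_eq_comp h] with p hp
    simp only [Function.comp_apply] at hp
    simp only [hcomm p]
    rw [Measure.integral_comp_smul volume (fun k' => (m₁ ((2 * Real.pi) • k') * 𝓕 (⇑u) k') *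
        (m₂ ((2 * Real.pi) • ((2 * Real.pi)⁻¹ • p - k')) * 𝓕 (⇑v) ((2 * Real.pi)⁻¹ • p - k')))]
    refine Eq.trans hp ?_
    simp only [finrank_euclideanSpace, Fintype.card_fin]
    rw [Complex.real_smul, ← mul_assoc, inv_pow, inv_inv, abs_of_pos (by positivity),
      inv_mul_cancel₀ (by exact_mod_cast pow_ne_zero 4 hpi), one_mul]

/-- Each null form is a finite combination of products of bounded multipliers, so the preceding
product formula extends by linearity. -/
lemma bilinearHat_of_sum_multiplier {ι : Type*} [Fintype ι] (c : ι → ℂ)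
    {m₁ m₂ : ι → Spacetime → ℂ} (hm₁ : ∀ i, Measurable (m₁ i))
    (hm₂ : ∀ i, Measurable (m₂ i)) (hb₁ : ∀ i p, ‖m₁ i p‖ ≤ 1) (hb₂ : ∀ i p, ‖m₂ i p‖ ≤ 1)
    {σ : Spacetime → Spacetime → ℝ} (hσ : ∀ p p', (σ p p' : ℂ) = ∑ i, c i * (m₁ i p * m₂ i p'))
    (u v : 𝓢(Spacetime, ℂ)) {w : Spacetime → ℂ}
    (hw : w = fun x => ∑ i, c i * (fourierMultiplier (m₁ i) u x * fourierMultiplier (m₂ i) v x)) :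
    Integrable w ∧
      angularFourier w =ᵐ[volume] bilinearHat σ (angularFourier u) (angularFourier v) := by
  have H := fun i => angularFourier_mul_fourierMultiplier (hm₁ i) (hm₂ i) (hb₁ i) (hb₂ i) u v
  have hint : ∀ i ∈ Finset.univ, Integrable
      (fun x => c i * (fourierMultiplier (m₁ i) u x * fourierMultiplier (m₂ i) v x)) :=
    fun i _ => (H i).1.const_mul (c i)
  refine ⟨hw ▸ integrable_finsetSum _ hint, ?_⟩
  have hae := ae_all_iff.2 fun i => (H i).2.2
  filter_upwards [hae] with p hp
  have e1 : angularFourier w p = ∑ i, c i * angularFourier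
      (fun x => fourierMultiplier (m₁ i) u x * fourierMultiplier (m₂ i) v x) p := by
    simp only [angularFourier, Real.fourier_eq, hw, Finset.smul_sum]
    rw [integral_finsetSum]
    · refine Finset.sum_congr rfl fun i _ => ?_
      rw [← integral_const_mul]
      refine integral_congr_ae (Filter.Eventually.of_forall fun x => ?_)
      simp only [Circle.smul_def, smul_eq_mul]
      ring
    · intro i hi
      exact (Real.fourierIntegral_convergent_iff _).2 (hint i hi)
  rw [e1, bilinearHat]
  have e2 : ∀ p', bilinearIntegrand σ (angularFourier u) (angularFourier v) p p' =
      ∑ i, c i * ((m₁ i p' * angularFourier u p') *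
        (m₂ i (p - p') * angularFourier v (p - p'))) := by
    intro p'
    rw [bilinearIntegrand, hσ, Finset.sum_mul, Finset.sum_mul]
    exact Finset.sum_congr rfl fun i _ => by ring
  simp only [e2]
  rw [integral_finsetSum _ fun i _ => ((H i).2.1 p).const_mul (c i), Finset.mul_sum]
  refine Finset.sum_congr rfl fun i _ => ?_
  rw [hp i, integral_const_mul]
  ring

lemma qij_schwartz (i j : Fin 3) (u v : 𝓢(Spacetime, ℂ)) :
    Integrable (qij i j u v) ∧ angularFourier (qij i j u v) =ᵐ[volume]
      bilinearHat (symbolQij i j) (angularFourier u) (angularFourier v) := by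
  -- The sign `1` is arbitrary: spatial components of the gradient symbol do not depend on it.
  refine bilinearHat_of_sum_multiplier ![1, -1]
    (m₁ := ![gradSymbol 1 i.succ, gradSymbol 1 j.succ])
    (m₂ := ![gradSymbol 1 j.succ, gradSymbol 1 i.succ]) ?_ ?_ ?_ ?_ ?_ u v ?_
  · simp [Fin.forall_fin_two, measurable_gradSymbol]
  · simp [Fin.forall_fin_two, measurable_gradSymbol]
  · simp [Fin.forall_fin_two, norm_gradSymbol_le]
  · simp [Fin.forall_fin_two, norm_gradSymbol_le]
  · intro p p'
    simp only [Fin.sum_univ_two, Matrix.cons_val_zero, Matrix.cons_val_one, symbolQij, gradSymbol, coneFreq,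
      Fin.cons_succ]
    push_cast
    ring_nf
    simp only [Complex.I_sq]
    ring
  · ext x
    simp only [Fin.sum_univ_two, Matrix.cons_val_zero, Matrix.cons_val_one,
      ← halfWaveGrad_eq_fourierMultiplier, qij, wedgeForm, halfWaveGrad, Fin.cons_succ]
    ring

lemma q0j_schwartz (ε₁ ε₂ : ℤˣ) (j : Fin 3) (u v : 𝓢(Spacetime, ℂ)) :
    Integrable (q0j ε₁ ε₂ j u v) ∧ angularFourier (q0j ε₁ ε₂ j u v) =ᵐ[volume]
      bilinearHat (symbolQ0j ε₁ ε₂ j) (angularFourier u) (angularFourier v) := by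
  refine bilinearHat_of_sum_multiplier ![1, -1]
    (m₁ := ![gradSymbol ε₁ 0, gradSymbol ε₁ j.succ])
    (m₂ := ![gradSymbol ε₂ j.succ, gradSymbol ε₂ 0]) ?_ ?_ ?_ ?_ ?_ u v ?_
  · simp [Fin.forall_fin_two, measurable_gradSymbol]
  · simp [Fin.forall_fin_two, measurable_gradSymbol]
  · simp [Fin.forall_fin_two, norm_gradSymbol_le]
  · simp [Fin.forall_fin_two, norm_gradSymbol_le]
  · intro p p'
    simp only [Fin.sum_univ_two, Matrix.cons_val_zero, Matrix.cons_val_one, symbolQ0j, gradSymbol, coneFreq,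
      Fin.cons_succ, Fin.cons_zero]
    push_cast
    ring_nf
    simp only [Complex.I_sq]
    ring
  · ext x
    simp only [Fin.sum_univ_two, Matrix.cons_val_zero, Matrix.cons_val_one,
      ← halfWaveGrad_eq_fourierMultiplier, q0j, wedgeForm]
    ring

lemma q0_schwartz (ε₁ ε₂ : ℤˣ) (u v : 𝓢(Spacetime, ℂ)) :
    Integrable (q0 ε₁ ε₂ u v) ∧ angularFourier (q0 ε₁ ε₂ u v) =ᵐ[volume]
      bilinearHat (symbolQ0 ε₁ ε₂) (angularFourier u) (angularFourier v) := by
  refine bilinearHat_of_sum_multiplier (Fin.cons (-1) fun _ : Fin 3 => 1)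
    (m₁ := gradSymbol ε₁) (m₂ := gradSymbol ε₂) (measurable_gradSymbol ε₁)
    (measurable_gradSymbol ε₂) (norm_gradSymbol_le ε₁) (norm_gradSymbol_le ε₂) ?_ u v ?_
  · intro p p'
    simp only [Fin.sum_univ_succ, Fin.sum_univ_zero, symbolQ0, gradSymbol, coneFreq,
      Fin.cons_succ, Fin.cons_zero]
    push_cast
    ring_nf
    simp only [Complex.I_sq]
    ring
  · ext x
    simp only [Fin.sum_univ_succ (n := 3), Fin.cons_zero, Fin.cons_succ,
      ← halfWaveGrad_eq_fourierMultiplier, q0, minkowskiForm]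
    ring_nf

/-! ### Integration in bipolar coordinates -/

lemma lintegral_comp_affine {c : ℝ} (hc : c ≠ 0) (d : ℝ) (g : ℝ → ℝ≥0∞) :
    ∫⁻ x, g x = ENNReal.ofReal |c| * ∫⁻ x, g (c * x + d) := by
  have hinj : Function.Injective (fun x : ℝ => c * x + d) := fun x y h => by
    simpa [hc] using h
  have h := lintegral_image_eq_lintegral_abs_deriv_mul (s := Set.univ) (f := fun x => c * x + d)
    (f' := fun _ => c) MeasurableSet.univ
    (fun x _ => (((hasDerivAt_id x).const_mul c).add_const d).hasDerivWithinAt.congr_deriv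
      (by simp)) hinj.injOn g
  have himg : (fun x : ℝ => c * x + d) '' Set.univ = Set.univ := by
    refine Set.image_univ_of_surjective fun y => ⟨(y - d) / c, ?_⟩
    field_simp
    ring
  rw [himg] at h
  simp only [Measure.restrict_univ] at h
  rw [h, lintegral_const_mul' _ _ ENNReal.ofReal_ne_top]

lemma lintegral_Ioi_comp_sq (g : ℝ → ℝ≥0∞) :
    ∫⁻ a in Set.Ioi (0 : ℝ), g a = ∫⁻ x in Set.Ioi (0 : ℝ), ENNReal.ofReal (2 * x) * g (x ^ 2) := by
  have h := lintegral_image_eq_lintegral_abs_deriv_mul (s := Set.Ioi (0 : ℝ)) (f := fun x => x ^ 2)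
    (f' := fun x => 2 * x) measurableSet_Ioi
    (fun x _ => by simpa using (hasDerivAt_pow 2 x).hasDerivWithinAt)
    (fun x hx y hy h => (pow_left_inj₀ (le_of_lt hx) (le_of_lt hy) two_ne_zero).1 h) g
  have himg : (fun x : ℝ => x ^ 2) '' Set.Ioi 0 = Set.Ioi 0 := by
    ext y
    constructor
    · rintro ⟨x, hx, rfl⟩
      exact pow_pos (Set.mem_Ioi.1 hx) 2
    · intro hy
      exact ⟨√y, Real.sqrt_pos.2 hy, Real.sq_sqrt (le_of_lt hy)⟩
  rw [himg] at h
  rw [h]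
  refine setLIntegral_congr_fun measurableSet_Ioi fun x hx => ?_
  have hx : 0 < x := hx
  rw [abs_of_pos (by positivity)]

/-- In terms of the squared radius `w`, area in the plane is `π dw`. -/
lemma lintegral_radial_plane {g : ℝ → ℝ≥0∞} (hg : Measurable g) :
    ∫⁻ y : ℝ × ℝ, g (y.1 ^ 2 + y.2 ^ 2) =
      ENNReal.ofReal Real.pi * ∫⁻ w in Set.Ioi (0 : ℝ), g w := by
  rw [← lintegral_comp_polarCoord_symm, lintegral_Ioi_comp_sq g]
  have h1 : ∀ p : ℝ × ℝ, ENNReal.ofReal p.1 • g ((polarCoord.symm p).1 ^ 2 +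
      (polarCoord.symm p).2 ^ 2) = ENNReal.ofReal p.1 * g (p.1 ^ 2) := by
    intro p
    rw [smul_eq_mul]
    congr 2
    simp only [polarCoord_symm_apply]
    linear_combination p.1 ^ 2 * Real.sin_sq_add_cos_sq p.2
  simp only [h1]
  rw [polarCoord_target, Measure.volume_eq_prod, setLIntegral_prod _ (by fun_prop)]
  simp only [lintegral_const, Measure.restrict_apply MeasurableSet.univ, Set.univ_inter,
    Real.volume_Ioo]
  rw [lintegral_mul_const _ (by fun_prop), mul_comm]
  have h2 : ∀ x : ℝ, ENNReal.ofReal (2 * x) * g (x ^ 2) =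
      2 * (ENNReal.ofReal x * g (x ^ 2)) := fun x => by
    rw [ENNReal.ofReal_mul (by norm_num), ENNReal.ofReal_ofNat, mul_assoc]
  simp only [h2]
  rw [lintegral_const_mul _ (by fun_prop), ← mul_assoc]
  congr 1
  rw [sub_neg_eq_add, ← two_mul, ENNReal.ofReal_mul (by norm_num), ENNReal.ofReal_ofNat, mul_comm]

lemma lintegral_cylindrical {G : ℝ × ℝ → ℝ≥0∞} (hG : Measurable G) :
    ∫⁻ η : EuclideanSpace ℝ (Fin 3), G (η 0, η 1 ^ 2 + η 2 ^ 2) =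
      ENNReal.ofReal Real.pi * ∫⁻ z : ℝ, ∫⁻ w in Set.Ioi (0 : ℝ), G (z, w) := by
  have h1 := PiLp.volume_preserving_ofLp (Fin 3)
  have h2 := volume_preserving_piFinSuccAbove (fun _ : Fin 3 => ℝ) 0
  have h3 := (MeasurePreserving.id (volume : Measure ℝ)).prod (volume_preserving_finTwoArrow ℝ)
  have h := h3.comp (h2.comp h1)
  have hm : Measurable fun q : ℝ × (ℝ × ℝ) => G (q.1, q.2.1 ^ 2 + q.2.2 ^ 2) := by fun_prop
  have e := h.lintegral_comp hm
  refine Eq.trans ?_ (e.trans ?_)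
  · rfl
  · rw [lintegral_prod _ hm.aemeasurable]
    have : ∀ z : ℝ, ∫⁻ y : ℝ × ℝ, G (z, y.1 ^ 2 + y.2 ^ 2) =
      ENNReal.ofReal Real.pi * ∫⁻ w in Set.Ioi (0 : ℝ), G (z, w) := fun z =>
      lintegral_radial_plane (g := fun w => G (z, w)) (by fun_prop)
    simp only [this]
    rw [lintegral_const_mul' _ _ ENNReal.ofReal_ne_top]

/-- A rotation takes `ξ` to the first axis; then `z` is the coordinate along `ξ` and `w` the squared
distance to that axis. -/
lemma lintegral_two_norms {ξ : EuclideanSpace ℝ (Fin 3)} (hξ : ξ ≠ 0) {K : ℝ × ℝ → ℝ≥0∞}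
    (hK : Measurable K) :
    ∫⁻ η, K (‖η‖ ^ 2, ‖ξ - η‖ ^ 2) = ENNReal.ofReal Real.pi *
      ∫⁻ z : ℝ, ∫⁻ w in Set.Ioi (0 : ℝ), K (z ^ 2 + w, (‖ξ‖ - z) ^ 2 + w) := by
  have hR : ‖ξ‖ ≠ 0 := norm_ne_zero_iff.2 hξ
  obtain ⟨b, hb⟩ := Orthonormal.exists_orthonormalBasis_extension_of_card_eq (𝕜 := ℝ)
    (E := EuclideanSpace ℝ (Fin 3)) (ι := Fin 3) (by simp)
    (v := fun _ => (‖ξ‖⁻¹ • ξ)) (s := {0}) (by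
      rw [orthonormal_iff_ite]
      rintro ⟨i, hi⟩ ⟨j, hj⟩
      have hi : i = 0 := hi
      have hj : j = 0 := hj
      subst hi hj
      simp [norm_smul, inv_mul_cancel₀ hR])
  have hb0 : b 0 = ‖ξ‖⁻¹ • ξ := hb 0 rfl
  have hξb : b.repr ξ = EuclideanSpace.single 0 ‖ξ‖ := by
    have : ξ = ‖ξ‖ • b 0 := by rw [hb0, smul_smul, mul_inv_cancel₀ hR, one_smul]
    conv_lhs => rw [this]
    rw [map_smul, b.repr_self]
    ext i
    simp
  have h := b.repr.measurePreserving.lintegral_comp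
    (f := fun ζ => K (‖ζ‖ ^ 2, ‖EuclideanSpace.single (0 : Fin 3) ‖ξ‖ - ζ‖ ^ 2)) (by fun_prop)
  simp only [← hξb, ← map_sub, LinearIsometryEquiv.norm_map] at h
  rw [h, hξb]
  rw [← lintegral_cylindrical (G := fun q => K (q.1 ^ 2 + q.2, (‖ξ‖ - q.1) ^ 2 + q.2)) (by fun_prop)]
  refine lintegral_congr fun ζ => ?_
  congr 2
  · simp [EuclideanSpace.norm_sq_eq, Fin.sum_univ_three]; ring
  · simp [EuclideanSpace.norm_sq_eq, Fin.sum_univ_three]; ring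

/-- The side lengths `(ρ, s)` of the nondegenerate triangles whose third side is `R`. -/
def triangleSet (R : ℝ) : Set (ℝ × ℝ) :=
  {q | 0 < q.1 ∧ 0 < q.2 ∧ |q.1 - R| < q.2 ∧ q.2 < q.1 + R}

/-- Take `a = z² + w` and `b = (R - z)² + w` as variables. Then `b = a + R² - 2 R z`, so the
Jacobian is `2 R`. -/
lemma lintegral_paraboloid {R : ℝ} (hR : 0 < R) {K : ℝ × ℝ → ℝ≥0∞} (hK : Measurable K) :
    ∫⁻ z : ℝ, ∫⁻ w in Set.Ioi (0 : ℝ), K (z ^ 2 + w, (R - z) ^ 2 + w) =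
      ENNReal.ofReal (2 * R)⁻¹ * ∫⁻ a : ℝ, ∫⁻ b : ℝ,
        {q : ℝ × ℝ | (q.1 + R ^ 2 - q.2) ^ 2 < 4 * R ^ 2 * q.1}.indicator K (a, b) := by
  set S := {q : ℝ × ℝ | (q.1 + R ^ 2 - q.2) ^ 2 < 4 * R ^ 2 * q.1} with hS
  have hSm : MeasurableSet S := by
    apply IsOpen.measurableSet
    refine isOpen_lt ?_ ?_ <;> fun_prop
  have hind : Measurable (S.indicator K) := hK.indicator hSm
  have hcR : (-(2 * R)) ≠ 0 := by linarith
  have h1 : ∀ z : ℝ, ∫⁻ w in Set.Ioi (0 : ℝ), K (z ^ 2 + w, (R - z) ^ 2 + w) =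
      ∫⁻ a : ℝ, S.indicator K (a, -(2 * R) * z + (a + R ^ 2)) := by
    intro z
    rw [← lintegral_indicator measurableSet_Ioi,
      ← lintegral_add_right_eq_self (fun a : ℝ => S.indicator K (a, -(2 * R) * z + (a + R ^ 2)))
        (z ^ 2)]
    refine lintegral_congr fun w => ?_
    simp only [Set.indicator_apply, Set.mem_Ioi, hS, Set.mem_ofPred_eq]
    -- With `a = w + z²`, the right side minus the left side is exactly `4 R² w`.
    have e1 : (w + z ^ 2 + R ^ 2 - (-(2 * R) * z + (w + z ^ 2 + R ^ 2))) ^ 2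
        < 4 * R ^ 2 * (w + z ^ 2) ↔ 0 < w := by
      have : 0 < 4 * R ^ 2 := by positivity
      constructor
      · intro h
        by_contra hw
        nlinarith
      · intro h
        nlinarith [mul_pos this h]
    simp only [e1]
    congr 2
    ext <;> simp <;> ring
  simp only [h1]
  rw [lintegral_lintegral_swap (by fun_prop)]
  rw [← lintegral_const_mul' _ _ ENNReal.ofReal_ne_top]
  refine lintegral_congr fun a => ?_
  rw [lintegral_comp_affine hcR (a + R ^ 2) (fun b => S.indicator K (a, b)), ← mul_assoc,
    ← ENNReal.ofReal_mul (by positivity), abs_neg, abs_of_pos (by positivity),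
    inv_mul_cancel₀ (by positivity), ENNReal.ofReal_one, one_mul]

/-- Integration in bipolar coordinates `(|η|, |ξ - η|)` in `ℝ³`. -/
lemma lintegral_bipolar {ξ : EuclideanSpace ℝ (Fin 3)} (hξ : ξ ≠ 0) {H : ℝ × ℝ → ℝ≥0∞}
    (hH : Measurable H) :
    ∫⁻ η, H (‖η‖, ‖ξ - η‖) = ENNReal.ofReal (2 * Real.pi * ‖ξ‖⁻¹) *
      ∫⁻ ρ : ℝ, ∫⁻ s : ℝ,
        (triangleSet ‖ξ‖).indicator (fun q => ENNReal.ofReal (q.1 * q.2) * H q) (ρ, s) := by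
  have hR : 0 < ‖ξ‖ := norm_pos_iff.2 hξ
  set R := ‖ξ‖
  have h := lintegral_two_norms hξ (K := fun q => H (√q.1, √q.2)) (by fun_prop)
  simp only [Real.sqrt_sq (norm_nonneg _)] at h
  rw [h, lintegral_paraboloid hR (K := fun q => H (√q.1, √q.2)) (by fun_prop)]
  set S := {q : ℝ × ℝ | (q.1 + R ^ 2 - q.2) ^ 2 < 4 * R ^ 2 * q.1} with hS
  set I := S.indicator (fun q => H (√q.1, √q.2)) with hI
  have hS1 : ∀ q ∈ S, 0 < q.1 ∧ 0 < q.2 := by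
    rintro ⟨a, b⟩ hq
    simp only [hS, Set.mem_ofPred_eq] at hq
    have ha : 0 < a := by
      have : 0 < 4 * R ^ 2 := by positivity
      by_contra hw
      nlinarith [sq_nonneg (a + R ^ 2 - b)]
    refine ⟨ha, ?_⟩
    by_contra hb
    simp only [not_lt] at hb
    nlinarith [sq_nonneg (a - R ^ 2), mul_nonneg ha.le (neg_nonneg.2 hb), sq_nonneg R, sq_nonneg b,
      mul_nonneg (sq_nonneg R) (neg_nonneg.2 hb)]
  have e1 : ∀ f : ℝ → ℝ≥0∞, (∀ a, a ≤ 0 → f a = 0) → ∫⁻ a, f a = ∫⁻ a in Set.Ioi (0 : ℝ), f a := by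
    intro f hf
    rw [← lintegral_indicator measurableSet_Ioi]
    refine lintegral_congr fun a => ?_
    by_cases ha : 0 < a
    · simp [ha]
    · simp [ha, hf a (not_lt.1 ha)]
  have hI0 : ∀ a b, (a ≤ 0 ∨ b ≤ 0) → I (a, b) = 0 := by
    intro a b hab
    refine Set.indicator_of_notMem (fun hq => ?_) _
    have := hS1 _ hq
    rcases hab with h | h
    · exact absurd this.1 (not_lt.2 h)
    · exact absurd this.2 (not_lt.2 h)
  have hJ : ∀ a : ℝ, ∫⁻ b, I (a, b) =
      ∫⁻ s in Set.Ioi (0 : ℝ), ENNReal.ofReal (2 * s) * I (a, s ^ 2) := by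
    intro a
    rw [e1 _ (fun b hb => hI0 a b (Or.inr hb)), lintegral_Ioi_comp_sq]
  have h2 : ∫⁻ a, ∫⁻ b, I (a, b) = ∫⁻ ρ in Set.Ioi (0 : ℝ), ENNReal.ofReal (2 * ρ) *
      ∫⁻ s in Set.Ioi (0 : ℝ), ENNReal.ofReal (2 * s) * I (ρ ^ 2, s ^ 2) := by
    simp only [hJ]
    rw [e1, lintegral_Ioi_comp_sq]
    intro a ha
    simp [hI0 a _ (Or.inl ha)]
  have h3 : ∫⁻ a, ∫⁻ b, I (a, b) = 4 * ∫⁻ ρ : ℝ, ∫⁻ s : ℝ,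
        (triangleSet R).indicator (fun q => ENNReal.ofReal (q.1 * q.2) * H q) (ρ, s) := by
    rw [h2, ← lintegral_const_mul' _ _ (by norm_num), ← lintegral_indicator measurableSet_Ioi]
    refine lintegral_congr fun ρ => ?_
    by_cases hρ : 0 < ρ
    · rw [Set.indicator_of_mem (Set.mem_Ioi.2 hρ), ← lintegral_const_mul' _ _ ENNReal.ofReal_ne_top,
        ← lintegral_indicator measurableSet_Ioi, ← lintegral_const_mul' _ _ (by norm_num)]
      refine lintegral_congr fun s => ?_
      by_cases hs : 0 < s
      · rw [Set.indicator_of_mem (Set.mem_Ioi.2 hs)]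
        -- For `a = ρ²`, `b = s²` the condition reads `|ρ² + R² - s²| < 2 R ρ`, that is, `(ρ - R)² <
        -- s² < (ρ + R)²`.
        have hiff : (ρ ^ 2, s ^ 2) ∈ S ↔ (ρ, s) ∈ triangleSet R := by
          simp only [hS, triangleSet, Set.mem_ofPred_eq, hρ, hs, true_and]
          rw [show 4 * R ^ 2 * ρ ^ 2 = (2 * R * ρ) ^ 2 by ring, sq_lt_sq,
            abs_of_pos (show 0 < 2 * R * ρ by positivity), abs_lt, abs_lt]
          constructor
          · rintro ⟨h1, h2⟩
            have h3 : (ρ - R) ^ 2 < s ^ 2 := by linarith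
            have h4 : s ^ 2 < (ρ + R) ^ 2 := by linarith
            exact ⟨abs_lt.1 (by rwa [sq_lt_sq, abs_of_pos hs] at h3),
              lt_of_pow_lt_pow_left₀ 2 (by positivity) h4⟩
          · rintro ⟨h1, h2⟩
            have h3 : (ρ - R) ^ 2 < s ^ 2 := by rw [sq_lt_sq, abs_of_pos hs]; exact abs_lt.2 h1
            have h4 : s ^ 2 < (ρ + R) ^ 2 := by gcongr
            constructor <;> linarith
        by_cases hT : (ρ, s) ∈ triangleSet R
        · rw [Set.indicator_of_mem hT, hI, Set.indicator_of_mem (hiff.2 hT)]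
          simp only [Real.sqrt_sq hρ.le, Real.sqrt_sq hs.le]
          rw [← mul_assoc, ← mul_assoc, ← ENNReal.ofReal_mul (by positivity)]
          congr 1
          rw [show 2 * ρ * (2 * s) = 4 * (ρ * s) by ring, ENNReal.ofReal_mul (by norm_num)]
          simp
        · rw [Set.indicator_of_notMem hT, hI, Set.indicator_of_notMem (fun h => hT (hiff.1 h))]
          simp
      · rw [Set.indicator_of_notMem (by simpa using hs), Set.indicator_of_notMem]
        · simp
        · exact fun h => hs h.2.1
    · rw [Set.indicator_of_notMem (by simpa using hρ)]
      have : ∀ s, (triangleSet R).indicator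
          (fun q => ENNReal.ofReal (q.1 * q.2) * H q) (ρ, s) = 0 :=
        fun s => Set.indicator_of_notMem (fun h => hρ h.1) _
      simp [this]
  rw [h3, ← mul_assoc, ← mul_assoc, ← ENNReal.ofReal_mul Real.pi_pos.le]
  congr 1
  rw [← ENNReal.ofReal_ofNat 4, ← ENNReal.ofReal_mul (by positivity)]
  congr 1
  field_simp
  ring

/-! ### The null form kernel on the level sets of `s ± ρ` -/

lemma lintegral_Ici_div_rpow {r d : ℝ} (hr : 1 < r) (hd : 0 < d) :
    ∫⁻ ρ in Set.Ioi (d / 2), ENNReal.ofReal (d⁻¹ * (d / ρ) ^ r) =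
      ENNReal.ofReal (2 ^ (r - 1) / (r - 1)) := by
  have hint := (integrableOn_Ioi_rpow_of_lt (a := -r) (c := d / 2) (by linarith)
    (by positivity)).const_mul (d⁻¹ * d ^ r)
  have e : ∀ ρ ∈ Set.Ioi (d / 2), ENNReal.ofReal (d⁻¹ * (d / ρ) ^ r) =
      ENNReal.ofReal (d⁻¹ * d ^ r * ρ ^ (-r)) := by
    intro ρ hρ
    have hρ : 0 < ρ := lt_trans (by positivity) (Set.mem_Ioi.1 hρ)
    rw [Real.div_rpow hd.le hρ.le, Real.rpow_neg hρ.le, div_eq_mul_inv, mul_assoc]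
  rw [setLIntegral_congr_fun measurableSet_Ioi e, ← ofReal_integral_eq_lintegral_ofReal hint]
  · rw [integral_const_mul, integral_Ioi_rpow_of_lt (by linarith) (by positivity)]
    congr 1
    rw [Real.div_rpow hd.le (by norm_num), show -r + 1 = -(r - 1) by ring, Real.rpow_neg hd.le,
      Real.rpow_neg (by norm_num : (0 : ℝ) ≤ 2), Real.rpow_sub_one hd.ne']
    have h1 : (0 : ℝ) < d ^ r := by positivity
    have h2 : (0 : ℝ) < 2 ^ (r - 1) := by positivity
    have h3 : r - 1 ≠ 0 := by linarith
    field_simp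
  · refine (ae_restrict_iff' measurableSet_Ioi).2 (Filter.Eventually.of_forall fun ρ hρ => ?_)
    have hρ : 0 < ρ := lt_trans (by positivity) (Set.mem_Ioi.1 hρ)
    change 0 ≤ d⁻¹ * d ^ r * ρ ^ (-r)
    positivity

/-- The majorant, in `(ρ, l)` with `l = s ± ρ`, of the null form kernel in bipolar coordinates. -/
def coneKernel (r R : ℝ) (q : ℝ × ℝ) : ℝ≥0∞ :=
  {q : ℝ × ℝ | |q.2 - R| < 2 * q.1}.indicator
    (fun q => ENNReal.ofReal (|q.2 - R|⁻¹ * (|q.2 - R| / q.1) ^ r)) q +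
  {q : ℝ × ℝ | |2 * q.1 - q.2| ≤ R}.indicator (fun _ => ENNReal.ofReal R⁻¹) q

lemma measurable_coneKernel (r R : ℝ) : Measurable (coneKernel r R) := by
  unfold coneKernel
  refine Measurable.add (Measurable.indicator (by fun_prop) ?_) (Measurable.indicator (by fun_prop) ?_)
  · exact (isOpen_lt (by fun_prop) (by fun_prop)).measurableSet
  · exact (isClosed_le (by fun_prop) (by fun_prop)).measurableSet

/-- The bound for the integral of `coneKernel`. -/
def coneKernelBound (r : ℝ) : ℝ≥0 := Real.toNNReal (2 ^ (r - 1) / (r - 1)) + 1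

/-- By scaling, the first part integrates to a constant depending only on `r`; the second is `R⁻¹`
on an interval of length `R`, which contributes the `1` in the bound. -/
lemma lintegral_coneKernel_le {r R : ℝ} (hr : 1 < r) (hR : 0 < R) (l : ℝ) :
    ∫⁻ ρ, coneKernel r R (ρ, l) ≤ coneKernelBound r := by
  unfold coneKernel
  rw [lintegral_add_left (by
    refine Measurable.indicator (by fun_prop) ?_ |>.comp (by fun_prop : Measurable fun ρ : ℝ => (ρ, l))
    exact (isOpen_lt (by fun_prop) (by fun_prop)).measurableSet), coneKernelBound, ENNReal.coe_add]
  refine add_le_add ?_ ?_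
  · rcases eq_or_ne l R with h | h
    · subst h
      simp [Set.indicator_apply]
    · have hd : 0 < |l - R| := abs_pos.2 (sub_ne_zero.2 h)
      refine le_of_eq (Eq.trans ?_ (lintegral_Ici_div_rpow hr hd))
      rw [← lintegral_indicator measurableSet_Ioi]
      refine lintegral_congr fun ρ => ?_
      have : |l - R| / 2 < ρ ↔ |l - R| < 2 * ρ := by
        constructor <;> intro h <;> linarith
      simp only [Set.indicator_apply, Set.mem_ofPred_eq, Set.mem_Ioi, this]
  · have : ∀ ρ : ℝ, {q : ℝ × ℝ | |2 * q.1 - q.2| ≤ R}.indicator (fun _ => ENNReal.ofReal R⁻¹) (ρ, l)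
        = (Set.Icc ((l - R) / 2) ((l + R) / 2)).indicator (fun _ => ENNReal.ofReal R⁻¹) ρ := by
      intro ρ
      have : |2 * ρ - l| ≤ R ↔ ρ ∈ Set.Icc ((l - R) / 2) ((l + R) / 2) := by
        rw [abs_le, Set.mem_Icc]
        constructor <;> rintro ⟨h1, h2⟩ <;> constructor <;> linarith
      simp only [Set.indicator_apply, Set.mem_ofPred_eq, this]
    simp only [this]
    rw [lintegral_indicator_const measurableSet_Icc, Real.volume_Icc, ← ENNReal.ofReal_mul (by positivity)]
    refine le_of_eq ?_
    rw [show R⁻¹ * ((l + R) / 2 - (l - R) / 2) = 1 by field_simp; ring]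
    simp

/-- `2 (|η||ζ| ∓ η·ζ)` in terms of the side lengths `ρ = |η|`, `s = |ζ|`, `R = |η + ζ|`. -/
def nullDefect (e R ρ s : ℝ) : ℝ := 2 * (ρ * s) - e * (R ^ 2 - ρ ^ 2 - s ^ 2)

lemma mul_rpow_le_of_le {x y κ : ℝ} {c : ℝ} (hc : 1 ≤ c) (hx : 0 ≤ x) (hxy : x ≤ c * y)
    (hκ0 : 0 ≤ κ) (hκ : κ ≤ 1) : x ^ κ ≤ c * y ^ κ := by
  have hy : 0 ≤ y := nonneg_of_mul_nonneg_right (hx.trans hxy) (by linarith)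
  calc x ^ κ ≤ (c * y) ^ κ := Real.rpow_le_rpow hx hxy hκ0
    _ = c ^ κ * y ^ κ := Real.mul_rpow (by linarith) hy
    _ ≤ c * y ^ κ := by
      gcongr
      exact Real.rpow_le_self_of_one_le hc hκ

/-- The left side is `d⁻¹ (d / ρ)^{1 + r/2}`, and the surplus exponent `1 - r/2` is nonnegative
while `d / ρ < 2`. -/
lemma inv_mul_rpow_le {r d ρ : ℝ} (hr : 0 < r) (hr2 : r ≤ 2) (hd : 0 < d) (hρ : 0 < ρ)
    (hdρ : d < 2 * ρ) : ρ⁻¹ * (d / ρ) ^ (r / 2) ≤ 2 * (d⁻¹ * (d / ρ) ^ r) := by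
  have hx : 0 < d / ρ := by positivity
  have h1 : (d / ρ) ^ (1 - r / 2) ≤ 2 := by
    have h3 : d / ρ ≤ 2 * 1 := by rw [div_le_iff₀ hρ]; linarith
    simpa using mul_rpow_le_of_le (κ := 1 - r / 2) (by norm_num) hx.le h3 (by linarith)
      (by linarith)
  have e1 : ρ⁻¹ = d⁻¹ * (d / ρ) := by field_simp
  calc ρ⁻¹ * (d / ρ) ^ (r / 2) = d⁻¹ * ((d / ρ) ^ r * (d / ρ) ^ (1 - r / 2)) := by
        rw [← Real.rpow_add hx, show r + (1 - r / 2) = 1 + r / 2 by ring, Real.rpow_add hx,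
          Real.rpow_one, e1, mul_assoc]
    _ ≤ d⁻¹ * ((d / ρ) ^ r * 2) := by gcongr
    _ = _ := by ring

/-- The defect factors as `(s + ρ - R)(s + ρ + R)` or `(R - (s - ρ))(R + (s - ρ))`, one factor being
`d = |s + e ρ - R|`. The triangle inequalities give `d < 2ρ`. The cases separate triangles whose
sides `ρ`, `s` are comparable, where `s / ρ ≤ 2`, from those with `s ≤ 2R`, where `s` cancels `R⁻¹`.
-/
lemma nullDefect_kernel_le {r R ρ s e : ℝ} (hr : 1 < r) (hr2 : r ≤ 2) (hR : 0 < R)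
    (he : e = 1 ∨ e = -1) (hT : (ρ, s) ∈ triangleSet R) (hρs : ρ ≤ s) :
    ENNReal.ofReal (R⁻¹ * (s / ρ * (nullDefect e R ρ s / (ρ * s)) ^ (r / 2))) ≤
      16 * coneKernel r R (ρ, s + e * ρ) := by
  obtain ⟨hρ, hs, h1, h2⟩ := hT
  simp only at hρ hs h1 h2
  have h1' := abs_lt.1 h1
  have hκ0 : 0 ≤ r / 2 := by linarith
  have hκ1 : r / 2 ≤ 1 := by linarith
  have e16 : (16 : ℝ≥0∞) = ENNReal.ofReal 16 := by simp
  have first : ∀ x : ℝ, 0 ≤ x → |s + e * ρ - R| < 2 * ρ →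
      x ≤ 16 * (|s + e * ρ - R|⁻¹ * (|s + e * ρ - R| / ρ) ^ r) →
      ENNReal.ofReal x ≤ 16 * coneKernel r R (ρ, s + e * ρ) := by
    intro x hx hd hle
    rw [coneKernel, Set.indicator_of_mem (by exact hd), mul_add, e16, ← ENNReal.ofReal_mul (by norm_num)]
    exact (ENNReal.ofReal_le_ofReal hle).trans le_self_add
  have second : ∀ x : ℝ, 0 ≤ x → |2 * ρ - (s + e * ρ)| ≤ R → x ≤ 16 * R⁻¹ →
      ENNReal.ofReal x ≤ 16 * coneKernel r R (ρ, s + e * ρ) := by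
    intro x hx hd hle
    rw [coneKernel, Set.indicator_of_mem (s := {q : ℝ × ℝ | |2 * q.1 - q.2| ≤ R}) (by exact hd),
      mul_add, e16, ← ENNReal.ofReal_mul (by norm_num) (q := R⁻¹)]
    exact (ENNReal.ofReal_le_ofReal hle).trans le_add_self
  rcases he with rfl | rfl
  · have hD : nullDefect 1 R ρ s = (s + ρ - R) * (s + ρ + R) := by unfold nullDefect; ring
    set d := s + ρ - R with hd
    have hd0 : 0 < d := by linarith
    have hdρ : d < 2 * ρ := by linarith
    have habs : |s + 1 * ρ - R| = d := by rw [one_mul]; exact abs_of_pos hd0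
    have hle : (nullDefect 1 R ρ s / (ρ * s)) ≤ 4 * (d / ρ) := by
      rw [hD, div_le_iff₀ (by positivity)]
      have : 4 * (d / ρ) * (ρ * s) = d * (4 * s) := by field_simp
      rw [this]
      exact mul_le_mul_of_nonneg_left (by linarith) hd0.le
    have h0 : 0 ≤ nullDefect 1 R ρ s / (ρ * s) := by
      rw [hD]; exact div_nonneg (mul_nonneg hd0.le (by linarith)) (by positivity)
    have hpow := mul_rpow_le_of_le (by norm_num) h0 hle hκ0 hκ1
    rcases le_or_gt s (2 * R) with hsR | hsR
    · refine first _ (by positivity) (by rwa [habs]) ?_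
      rw [habs]
      calc R⁻¹ * (s / ρ * (nullDefect 1 R ρ s / (ρ * s)) ^ (r / 2))
          ≤ R⁻¹ * ((2 * R) / ρ * (4 * (d / ρ) ^ (r / 2))) := by gcongr
        _ = 8 * (ρ⁻¹ * (d / ρ) ^ (r / 2)) := by field_simp; ring
        _ ≤ 8 * (2 * (d⁻¹ * (d / ρ) ^ r)) :=
          mul_le_mul_of_nonneg_left (inv_mul_rpow_le (by linarith) hr2 hd0 hρ hdρ) (by norm_num)
        _ = _ := by ring
    -- Since `s > 2R`, one has `ρ > s - R > s / 2`, and `|ρ - s| < R` places the point in the strip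
    -- of the second part of the kernel.
    · refine second _ (by positivity) ?_ ?_
      · rw [abs_le]; constructor <;> linarith
      · have hx : (d / ρ) ^ (r / 2) ≤ 2 := by
          have h3 : d / ρ ≤ 2 * 1 := by rw [div_le_iff₀ hρ]; linarith
          have := mul_rpow_le_of_le (by norm_num) (by positivity) h3 hκ0 hκ1
          simpa using this
        have hy : s / ρ ≤ 2 := by rw [div_le_iff₀ hρ]; linarith
        calc R⁻¹ * (s / ρ * (nullDefect 1 R ρ s / (ρ * s)) ^ (r / 2))
            ≤ R⁻¹ * (2 * (4 * 2)) := by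
              gcongr
              exact hpow.trans (by gcongr)
        _ = _ := by ring
  · have hD : nullDefect (-1) R ρ s = (R - (s - ρ)) * (R + (s - ρ)) := by unfold nullDefect; ring
    set d := R - (s - ρ) with hd
    have hd0 : 0 < d := by linarith
    have hdρ : d < 2 * ρ := by linarith
    have habs : |s + -1 * ρ - R| = d := by
      rw [show s + -1 * ρ - R = -d by rw [hd]; ring, abs_neg, abs_of_pos hd0]
    have h0 : 0 ≤ nullDefect (-1) R ρ s / (ρ * s) := by
      rw [hD]; exact div_nonneg (mul_nonneg hd0.le (by linarith)) (by positivity)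
    have hDle : nullDefect (-1) R ρ s ≤ 2 * R * d := by
      rw [hD]; nlinarith
    refine first _ (by positivity) (by rwa [habs]) ?_
    rw [habs]
    rcases le_or_gt ρ R with hρR | hρR
    -- Here `s < ρ + R ≤ 2R`, so `2R / s ≥ 1` can be pulled out of the power `r / 2 ≤ 1`.
    · have hle : nullDefect (-1) R ρ s / (ρ * s) ≤ 2 * R / s * (d / ρ) := by
        rw [div_mul_div_comm, mul_comm s ρ]
        gcongr
      have hpow := mul_rpow_le_of_le (by rw [le_div_iff₀ hs]; linarith) h0 hle hκ0 hκ1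
      calc R⁻¹ * (s / ρ * (nullDefect (-1) R ρ s / (ρ * s)) ^ (r / 2))
          ≤ R⁻¹ * (s / ρ * (2 * R / s * (d / ρ) ^ (r / 2))) := by gcongr
        _ = 2 * (ρ⁻¹ * (d / ρ) ^ (r / 2)) := by field_simp
        _ ≤ 2 * (2 * (d⁻¹ * (d / ρ) ^ r)) :=
          mul_le_mul_of_nonneg_left (inv_mul_rpow_le (by linarith) hr2 hd0 hρ hdρ) (by norm_num)
        _ ≤ _ := by nlinarith [show 0 ≤ d⁻¹ * (d / ρ) ^ r by positivity]
    -- Here `s < ρ + R < 2ρ`. Keeping `(d / ρ)²` inside makes the power `r / 2` yield `(d / ρ)^r`,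
    -- and `2R / d ≥ 1` because `ρ ≤ s` gives `d ≤ R`.
    · have hle : nullDefect (-1) R ρ s / (ρ * s) ≤ 2 * R / d * (d / ρ) ^ 2 := by
        calc nullDefect (-1) R ρ s / (ρ * s) ≤ 2 * R * d / (ρ * ρ) := by gcongr
          _ = _ := by field_simp
      have hpow := mul_rpow_le_of_le (by rw [le_div_iff₀ hd0]; linarith) h0 hle hκ0 hκ1
      have e : ((d / ρ) ^ 2) ^ (r / 2) = (d / ρ) ^ r := by
        rw [← Real.rpow_natCast, ← Real.rpow_mul (by positivity)]
        congr 1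
        push_cast
        ring
      rw [e] at hpow
      have hy : s / ρ ≤ 2 := by rw [div_le_iff₀ hρ]; linarith
      calc R⁻¹ * (s / ρ * (nullDefect (-1) R ρ s / (ρ * s)) ^ (r / 2))
          ≤ R⁻¹ * (2 * (2 * R / d * (d / ρ) ^ r)) := by gcongr
        _ = 4 * (d⁻¹ * (d / ρ) ^ r) := by field_simp; ring
        _ ≤ _ := by nlinarith [show 0 ≤ d⁻¹ * (d / ρ) ^ r by positivity]

/-- With `l = s + e ρ` in place of `s`, the factor `φ` no longer depends on `ρ`, so the kernel is
integrated in `ρ` first. -/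
lemma lintegral_coneKernel_mul_le {r R : ℝ} (hr : 1 < r) (hR : 0 < R) {e c τ : ℝ}
    (hc : c = 1 ∨ c = -1) {φ : ℝ → ℝ≥0∞} (hφ : Measurable φ) :
    ∫⁻ ρ : ℝ, ∫⁻ s : ℝ, 16 * coneKernel r R (ρ, s + e * ρ) * φ (τ + c * (s + e * ρ)) ≤
      16 * coneKernelBound r * ∫⁻ t, φ t := by
  have hk := measurable_coneKernel r R
  have hc0 : c ≠ 0 := by rcases hc with rfl | rfl <;> norm_num
  have hc1 : |c| = 1 := by rcases hc with rfl | rfl <;> norm_num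
  calc ∫⁻ ρ : ℝ, ∫⁻ s : ℝ, 16 * coneKernel r R (ρ, s + e * ρ) * φ (τ + c * (s + e * ρ))
      = ∫⁻ ρ : ℝ, ∫⁻ l : ℝ, 16 * coneKernel r R (ρ, l) * φ (τ + c * l) :=
        lintegral_congr fun ρ => lintegral_add_right_eq_self
          (fun l => 16 * coneKernel r R (ρ, l) * φ (τ + c * l)) (e * ρ)
    _ = ∫⁻ l : ℝ, ∫⁻ ρ : ℝ, 16 * coneKernel r R (ρ, l) * φ (τ + c * l) :=
        lintegral_lintegral_swap (by fun_prop)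
    _ = ∫⁻ l : ℝ, 16 * (∫⁻ ρ : ℝ, coneKernel r R (ρ, l)) * φ (τ + c * l) := by
        refine lintegral_congr fun l => ?_
        rw [lintegral_mul_const _ (by fun_prop), lintegral_const_mul _ (by fun_prop)]
    _ ≤ ∫⁻ l : ℝ, 16 * coneKernelBound r * φ (τ + c * l) := by
        gcongr with l
        exact lintegral_coneKernel_le hr hR l
    _ = _ := by
        rw [lintegral_const_mul _ (by fun_prop), lintegral_comp_affine hc0 τ φ, hc1]
        simp [add_comm]

/-- The kernel of the null form estimate in bipolar coordinates, with the weight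
`min(ρ, s)⁻²` in place of the Japanese brackets. -/
def bipolarKernel (r e R : ℝ) (q : ℝ × ℝ) : ℝ :=
  (nullDefect e R q.1 q.2 / (q.1 * q.2)) ^ (r / 2) * ((min q.1 q.2) ^ 2)⁻¹

lemma measurable_bipolarKernel (r e R : ℝ) : Measurable (bipolarKernel r e R) := by
  unfold bipolarKernel nullDefect
  fun_prop

lemma triangleSet_swap {R ρ s : ℝ} (h : (ρ, s) ∈ triangleSet R) : (s, ρ) ∈ triangleSet R := by
  obtain ⟨h1, h2, h3, h4⟩ := h
  simp only at h1 h2 h3 h4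
  have := abs_lt.1 h3
  refine ⟨h2, h1, abs_lt.2 ⟨?_, ?_⟩, ?_⟩ <;> simp only <;> linarith

lemma bipolarKernel_swap (r e R ρ s : ℝ) : bipolarKernel r e R (s, ρ) = bipolarKernel r e R (ρ, s) := by
  simp only [bipolarKernel, nullDefect, min_comm s ρ, mul_comm s ρ]
  congr 4
  ring

lemma bipolarKernel_le {r R ρ s e : ℝ} (hr : 1 < r) (hr2 : r ≤ 2) (hR : 0 < R)
    (he : e = 1 ∨ e = -1) (hT : (ρ, s) ∈ triangleSet R) (hρs : ρ ≤ s) :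
    ENNReal.ofReal R⁻¹ * ENNReal.ofReal (ρ * s) * ENNReal.ofReal (bipolarKernel r e R (ρ, s)) ≤
      16 * coneKernel r R (ρ, s + e * ρ) := by
  have hρ : 0 < ρ := hT.1
  have hs : 0 < s := hT.2.1
  refine le_trans (le_of_eq ?_) (nullDefect_kernel_le hr hr2 hR he hT hρs)
  rw [← ENNReal.ofReal_mul (by positivity), ← ENNReal.ofReal_mul (by positivity)]
  congr 1
  simp only [bipolarKernel, min_eq_left hρs]
  field_simp

/-- The triangle set is split by which of `ρ`, `s` is shorter; the kernel is symmetric, so each half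
is an instance of the same bound, whence the factor `2`. -/
lemma lintegral_bipolarKernel_le {r : ℝ} (hr : 1 < r) (hr2 : r ≤ 2)
    {ξ : EuclideanSpace ℝ (Fin 3)} (hξ : ξ ≠ 0) {e₁ e₂ τ : ℝ} (h₁ : e₁ = 1 ∨ e₁ = -1)
    (h₂ : e₂ = 1 ∨ e₂ = -1) {φ : ℝ → ℝ≥0∞} (hφ : Measurable φ) :
    ∫⁻ η, ENNReal.ofReal (bipolarKernel r (e₁ * e₂) ‖ξ‖ (‖η‖, ‖ξ - η‖)) *
      φ (τ + (e₁ * ‖η‖ + e₂ * ‖ξ - η‖)) ≤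
      ENNReal.ofReal (2 * Real.pi) * (2 * (16 * coneKernelBound r)) * ∫⁻ t, φ t := by
  have hR : 0 < ‖ξ‖ := norm_pos_iff.2 hξ
  have hb := measurable_bipolarKernel r (e₁ * e₂) ‖ξ‖
  have hk := measurable_coneKernel r ‖ξ‖
  have he : e₁ * e₂ = 1 ∨ e₁ * e₂ = -1 := by
    rcases h₁ with rfl | rfl <;> rcases h₂ with rfl | rfl <;> norm_num
  have h11 : e₁ * e₁ = 1 := by rcases h₁ with rfl | rfl <;> norm_num
  have h22 : e₂ * e₂ = 1 := by rcases h₂ with rfl | rfl <;> norm_num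
  rw [lintegral_bipolar hξ (H := fun q => ENNReal.ofReal (bipolarKernel r (e₁ * e₂) ‖ξ‖ q) *
    φ (τ + (e₁ * q.1 + e₂ * q.2))) (by fun_prop), ENNReal.ofReal_mul (by positivity), mul_assoc,
    mul_assoc]
  refine mul_le_mul' le_rfl ?_
  rw [← lintegral_const_mul' _ _ ENNReal.ofReal_ne_top]
  simp only [← lintegral_const_mul' (ENNReal.ofReal ‖ξ‖⁻¹) _ ENNReal.ofReal_ne_top]
  set F₁ : ℝ → ℝ → ℝ≥0∞ := fun ρ s =>
    16 * coneKernel r ‖ξ‖ (ρ, s + (e₁ * e₂) * ρ) * φ (τ + e₂ * (s + (e₁ * e₂) * ρ)) with hF₁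
  set F₂ : ℝ → ℝ → ℝ≥0∞ := fun s ρ =>
    16 * coneKernel r ‖ξ‖ (s, ρ + (e₁ * e₂) * s) * φ (τ + e₁ * (ρ + (e₁ * e₂) * s)) with hF₂
  have hF₁m : Measurable (Function.uncurry F₁) := by
    simp only [hF₁, Function.uncurry_def]; fun_prop
  have hF₂m : Measurable (Function.uncurry F₂) := by
    simp only [hF₂, Function.uncurry_def]; fun_prop
  calc _ ≤ ∫⁻ ρ : ℝ, ∫⁻ s : ℝ, (F₁ ρ s + F₂ s ρ) := by
        gcongr with ρ s
        by_cases hT : (ρ, s) ∈ triangleSet ‖ξ‖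
        · rw [Set.indicator_of_mem hT, ← mul_assoc, ← mul_assoc]
          rcases le_total ρ s with h | h
          · refine le_trans ?_ le_self_add
            -- The sign of the longer side is factored out, leaving the longer side plus `e₁ e₂`
            -- times the shorter one.
            have e : e₁ * ρ + e₂ * s = e₂ * (s + (e₁ * e₂) * ρ) := by
              linear_combination -e₁ * ρ * h22
            simp only [hF₁, e]
            refine mul_le_mul' ?_ le_rfl
            exact bipolarKernel_le hr hr2 hR he hT h
          · refine le_trans ?_ le_add_self
            have e : e₁ * ρ + e₂ * s = e₁ * (ρ + (e₁ * e₂) * s) := by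
              linear_combination -e₂ * s * h11
            simp only [hF₂, e]
            refine mul_le_mul' ?_ le_rfl
            have := bipolarKernel_le hr hr2 hR he (triangleSet_swap hT) h
            rwa [bipolarKernel_swap, mul_comm s ρ] at this
        · rw [Set.indicator_of_notMem hT]
          simp
    _ = (∫⁻ ρ : ℝ, ∫⁻ s : ℝ, F₁ ρ s) + ∫⁻ s : ℝ, ∫⁻ ρ : ℝ, F₂ s ρ := by
        rw [lintegral_lintegral_swap (f := F₂) hF₂m.aemeasurable,
          ← lintegral_add_left hF₁m.lintegral_prod_right]
        refine lintegral_congr fun ρ => ?_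
        exact lintegral_add_left (hF₁m.comp measurable_prodMk_left) _
    _ ≤ 16 * coneKernelBound r * (∫⁻ t, φ t) + 16 * coneKernelBound r * ∫⁻ t, φ t :=
        add_le_add (lintegral_coneKernel_mul_le hr hR h₂ hφ) (lintegral_coneKernel_mul_le hr hR h₁ hφ)
    _ = _ := by ring

/-! ### The null structure of the symbols -/

lemma sgn_eq (ε : ℤˣ) : sgn ε = 1 ∨ sgn ε = -1 := by
  rcases Int.units_eq_one_or ε with h | h <;> simp [sgn, h]

lemma nullDefect_eq_inner (e : ℝ) (η ζ : EuclideanSpace ℝ (Fin 3)) :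
    nullDefect e ‖η + ζ‖ ‖η‖ ‖ζ‖ = 2 * (‖η‖ * ‖ζ‖ - e * inner ℝ η ζ) := by
  rw [nullDefect, norm_add_sq_real]
  ring

/-- A measurable symbol which is controlled by the angle between its two spatial frequencies, in
the way that null forms on half-waves of signs `ε₁`, `ε₂` are. -/
structure NullSymbol (ε₁ ε₂ : ℤˣ) (σ : Spacetime → Spacetime → ℝ) : Prop where
  measurable : Measurable (Function.uncurry σ)
  eq_zero : ∀ p p', ‖spatial p‖ * ‖spatial p'‖ = 0 → σ p p' = 0
  sq_le : ∀ p p', 0 < ‖spatial p‖ → 0 < ‖spatial p'‖ →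
    σ p p' ^ 2 ≤ nullDefect (sgn ε₁ * sgn ε₂) ‖spatial p + spatial p'‖ ‖spatial p‖ ‖spatial p'‖ /
      (‖spatial p‖ * ‖spatial p'‖)

lemma div_sq_le_of_sq_le {x ρs D : ℝ} (h : 0 < ρs) (hx : x ^ 2 ≤ 2 * D * ρs) :
    (-x / ρs) ^ 2 ≤ 2 * D / ρs := by
  rw [div_pow, neg_sq, div_le_div_iff₀ (by positivity) h]
  nlinarith

lemma nullSymbol_symbolQij (ε₁ ε₂ : ℤˣ) (i j : Fin 3) : NullSymbol ε₁ ε₂ (symbolQij i j) := by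
  refine ⟨?_, fun p p' h => by simp [symbolQij, h], fun p p' h h' => ?_⟩
  · have := continuous_spatial
    unfold symbolQij
    simp only [Function.uncurry_def]
    fun_prop
  · rw [nullDefect_eq_inner]
    refine div_sq_le_of_sq_le (by positivity) ?_
    set η := spatial p
    set ζ := spatial p'
    -- Lagrange's identity for `|η × ζ|²`. The right side factors as `(|η||ζ| - η·ζ)(|η||ζ| + η·ζ)`,
    -- and either factor is at most `2|η||ζ|`, so both sign combinations are covered.
    have hlag : (η i * ζ j - η j * ζ i) ^ 2 ≤ ‖η‖ ^ 2 * ‖ζ‖ ^ 2 - inner ℝ η ζ ^ 2 := by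
      simp only [EuclideanSpace.norm_sq_eq, PiLp.inner_apply, Fin.sum_univ_three, Real.norm_eq_abs,
        sq_abs, RCLike.inner_apply, conj_trivial]
      fin_cases i <;> fin_cases j <;> simp <;>
      nlinarith [sq_nonneg (η 0 * ζ 1 - η 1 * ζ 0), sq_nonneg (η 0 * ζ 2 - η 2 * ζ 0),
        sq_nonneg (η 1 * ζ 2 - η 2 * ζ 1)]
    have hcs := abs_le.1 (abs_real_inner_le_norm η ζ)
    have he : sgn ε₁ * sgn ε₂ = 1 ∨ sgn ε₁ * sgn ε₂ = -1 := by
      rcases sgn_eq ε₁ with h1 | h1 <;> rcases sgn_eq ε₂ with h2 | h2 <;> simp [h1, h2]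
    rcases he with he | he <;> rw [he] <;> nlinarith

lemma nullSymbol_symbolQ0j (ε₁ ε₂ : ℤˣ) (j : Fin 3) :
    NullSymbol ε₁ ε₂ (symbolQ0j ε₁ ε₂ j) := by
  refine ⟨?_, fun p p' h => by simp [symbolQ0j, h], fun p p' h h' => ?_⟩
  · have := continuous_spatial
    have := measurable_coneFreq ε₁ 0
    have := measurable_coneFreq ε₂ 0
    unfold symbolQ0j
    simp only [Function.uncurry_def]
    fun_prop
  · rw [nullDefect_eq_inner]
    refine div_sq_le_of_sq_le (by positivity) ?_
    simp only [coneFreq, Fin.cons_zero]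
    set η := spatial p
    set ζ := spatial p'
    -- Up to sign the numerator is the `j`-th coordinate of this vector, whose squared norm is
    -- `|η||ζ|` times the null defect.
    have h1 := PiLp.norm_apply_le ((sgn ε₂ * ‖ζ‖) • η - (sgn ε₁ * ‖η‖) • ζ) j
    have h2 := pow_le_pow_left₀ (norm_nonneg _) h1 2
    rw [norm_sub_sq_real, Real.norm_eq_abs, sq_abs] at h2
    simp only [PiLp.sub_apply, PiLp.smul_apply, smul_eq_mul, norm_smul, norm_mul,
      Real.norm_eq_abs, abs_norm, abs_sgn, one_mul, real_inner_smul_left, real_inner_smul_right] at h2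
    calc _ = (sgn ε₂ * ‖ζ‖ * η j - sgn ε₁ * ‖η‖ * ζ j) ^ 2 := by ring
      _ ≤ _ := h2
      _ = _ := by ring

/-- The numerator is, up to sign, `|η||ζ| - e η·ζ` with `e = ±1`; one factor of its square is
bounded by `2|η||ζ|`. -/
lemma nullSymbol_symbolQ0 (ε₁ ε₂ : ℤˣ) : NullSymbol ε₁ ε₂ (symbolQ0 ε₁ ε₂) := by
  refine ⟨?_, fun p p' h => by simp [symbolQ0, h], fun p p' h h' => ?_⟩
  · have := continuous_spatial
    have := measurable_coneFreq ε₁ 0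
    have := measurable_coneFreq ε₂ 0
    unfold symbolQ0
    simp only [Function.uncurry_def]
    fun_prop
  · rw [nullDefect_eq_inner]
    refine div_sq_le_of_sq_le (by positivity) ?_
    simp only [coneFreq, Fin.cons_zero]
    set η := spatial p
    set ζ := spatial p'
    have hi : ∑ i : Fin 3, η i * ζ i = inner ℝ η ζ := by
      simp only [PiLp.inner_apply, RCLike.inner_apply, conj_trivial, mul_comm]
    rw [hi]
    have hcs := abs_le.1 (abs_real_inner_le_norm η ζ)
    have he : sgn ε₁ * sgn ε₂ = 1 ∨ sgn ε₁ * sgn ε₂ = -1 := by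
      rcases sgn_eq ε₁ with h1 | h1 <;> rcases sgn_eq ε₂ with h2 | h2 <;> simp [h1, h2]
    rw [show -(-(sgn ε₁ * ‖η‖) * -(sgn ε₂ * ‖ζ‖)) = -(sgn ε₁ * sgn ε₂) * (‖η‖ * ‖ζ‖) by ring]
    rcases he with he | he <;> rw [he] <;> nlinarith

/-! ### Weights and the uniform bound for the weighted symbol -/

lemma one_le_japanese (x : ℝ) : 1 ≤ japanese x :=
  Real.one_le_sqrt.2 (by nlinarith [sq_nonneg x])

lemma continuous_japanese : Continuous japanese := by
  unfold japanese
  fun_prop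

lemma sq_le_japanese_sq (x : ℝ) : x ^ 2 ≤ japanese x ^ 2 := by
  rw [japanese, Real.sq_sqrt (by positivity)]
  linarith

lemma japanese_mono {x y : ℝ} (hx : 0 ≤ x) (h : x ≤ y) : japanese x ≤ japanese y :=
  Real.sqrt_le_sqrt (by gcongr)

lemma lintegral_japanese_lt_top {c : ℝ} (hc : 1 < c) :
    ∫⁻ t, ENNReal.ofReal (japanese t ^ (-c)) < ∞ := by
  have h := integrable_rpow_neg_one_add_norm_sq (E := ℝ) (μ := volume) (r := c) (by simpa using hc)
  have e : ∀ t : ℝ, japanese t ^ (-c) = (1 + ‖t‖ ^ 2) ^ (-c / 2) := by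
    intro t
    rw [japanese, Real.sqrt_eq_rpow, ← Real.rpow_mul (by positivity), Real.norm_eq_abs, sq_abs]
    congr 1
    ring
  simp only [e]
  exact h.lintegral_lt_top

/-- Both brackets are at least the bracket of the smaller frequency, so only the sum `α₁ + α₂`
matters, and `(α₁ + α₂) r ≥ 2`. -/
lemma min_sq_le_weight {r α₁ α₂ ρ s : ℝ} (hr : 0 < r) (hα₁ : 0 ≤ α₁) (hα₂ : 0 ≤ α₂)
    (hα : 2 / r ≤ α₁ + α₂) (hρ : 0 < ρ) (hs : 0 < s) :
    min ρ s ^ 2 ≤ (japanese ρ ^ α₁ * japanese s ^ α₂) ^ r := by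
  have hm : 0 < min ρ s := lt_min hρ hs
  have hj := one_le_japanese (min ρ s)
  have hj0 : 0 < japanese (min ρ s) := by linarith
  have hjρ : 0 < japanese ρ := zero_lt_one.trans_le (one_le_japanese ρ)
  calc min ρ s ^ 2 ≤ japanese (min ρ s) ^ 2 := sq_le_japanese_sq _
    _ = japanese (min ρ s) ^ (2 : ℝ) := by norm_cast
    _ ≤ japanese (min ρ s) ^ ((α₁ + α₂) * r) :=
      Real.rpow_le_rpow_of_exponent_le hj ((div_le_iff₀ hr).1 hα)
    _ = (japanese (min ρ s) ^ α₁ * japanese (min ρ s) ^ α₂) ^ r := by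
      rw [Real.rpow_mul hj0.le, Real.rpow_add hj0]
    _ ≤ _ := by
      gcongr
      · exact japanese_mono hm.le (min_le_left _ _)
      · exact japanese_mono hm.le (min_le_right _ _)

/-- The weight of the space `X^r_{s,b,±}`. -/
def xWeight (s b : ℝ) (ε : ℤˣ) (p : Spacetime) : ℝ :=
  japanese ‖spatial p‖ ^ s * japanese (p 0 + sgn ε * ‖spatial p‖) ^ b

lemma xWeight_pos (s b : ℝ) (ε : ℤˣ) (p : Spacetime) : 0 < xWeight s b ε p := by
  have h1 := one_le_japanese ‖spatial p‖
  have h2 := one_le_japanese (p 0 + sgn ε * ‖spatial p‖)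
  unfold xWeight
  positivity

lemma measurable_xWeight (s b : ℝ) (ε : ℤˣ) : Measurable (xWeight s b ε) := by
  have := continuous_spatial
  have := continuous_japanese.measurable
  unfold xWeight
  fun_prop

/-- The symbol divided by the weights. -/
def weightedSymbol (α₁ α₂ b : ℝ) (ε₁ ε₂ : ℤˣ) (σ : Spacetime → Spacetime → ℝ)
    (p p' : Spacetime) : ℝ≥0∞ :=
  ENNReal.ofReal (|σ p' (p - p')| / (xWeight α₁ b ε₁ p' * xWeight α₂ b ε₂ (p - p')))

lemma weightedSymbol_rpow_le {r α₁ α₂ b : ℝ} (hr : 0 < r) (hα₁ : 0 ≤ α₁) (hα₂ : 0 ≤ α₂)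
    (hα : 2 / r ≤ α₁ + α₂) {ε₁ ε₂ : ℤˣ} {σ : Spacetime → Spacetime → ℝ}
    (hσ : NullSymbol ε₁ ε₂ σ) (p p' : Spacetime) :
    weightedSymbol α₁ α₂ b ε₁ ε₂ σ p p' ^ r ≤
      ENNReal.ofReal (bipolarKernel r (sgn ε₁ * sgn ε₂) ‖spatial p‖
        (‖spatial p'‖, ‖spatial p - spatial p'‖)) *
      (ENNReal.ofReal (japanese (p' 0 + sgn ε₁ * ‖spatial p'‖) ^ (-(r * b))) *
      ENNReal.ofReal (japanese (p 0 - p' 0 + sgn ε₂ * ‖spatial p - spatial p'‖) ^ (-(r * b)))) := by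
  rw [weightedSymbol]
  -- Where a spatial frequency vanishes the symbol is zero, so the singular kernel need not be
  -- controlled there.
  by_cases h0 : ‖spatial p'‖ * ‖spatial (p - p')‖ = 0
  · rw [hσ.eq_zero _ _ h0]
    simp [ENNReal.zero_rpow_of_pos hr]
  rw [← spatial_sub]
  have hne := mul_ne_zero_iff.1 h0
  have hρ : 0 < ‖spatial p'‖ := lt_of_le_of_ne (norm_nonneg _) hne.1.symm
  have hs : 0 < ‖spatial (p - p')‖ := lt_of_le_of_ne (norm_nonneg _) hne.2.symm
  have hsq := hσ.sq_le p' (p - p') hρ hs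
  have hw := min_sq_le_weight hr hα₁ hα₂ hα hρ hs
  rw [show spatial p' + spatial (p - p') = spatial p by rw [spatial_sub]; abel] at hsq
  have hx1 := xWeight_pos α₁ b ε₁ p'
  have hx2 := xWeight_pos α₂ b ε₂ (p - p')
  simp only [bipolarKernel]
  unfold xWeight at *
  rw [show (p - p') 0 = p 0 - p' 0 from rfl] at *
  set ρ := ‖spatial p'‖
  set s := ‖spatial (p - p')‖
  have hj1 := one_le_japanese (p' 0 + sgn ε₁ * ρ)
  have hj2 := one_le_japanese (p 0 - p' 0 + sgn ε₂ * s)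
  have hj3 := one_le_japanese ρ
  have hj4 := one_le_japanese s
  set J₁ := japanese (p' 0 + sgn ε₁ * ρ)
  set J₂ := japanese (p 0 - p' 0 + sgn ε₂ * s)
  set D := nullDefect (sgn ε₁ * sgn ε₂) ‖spatial p‖ ρ s / (ρ * s)
  have hm : 0 < min ρ s := lt_min hρ hs
  have hD : 0 ≤ D := (sq_nonneg _).trans hsq
  rw [ENNReal.ofReal_rpow_of_nonneg (by positivity) hr.le, ← ENNReal.ofReal_mul (by positivity),
    ← ENNReal.ofReal_mul (by positivity)]
  refine ENNReal.ofReal_le_ofReal ?_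
  have hσr : |σ p' (p - p')| ^ r ≤ D ^ (r / 2) := by
    have : |σ p' (p - p')| ^ r = (σ p' (p - p') ^ 2) ^ (r / 2) := by
      rw [← sq_abs, ← Real.rpow_natCast, ← Real.rpow_mul (abs_nonneg _)]
      congr 1
      push_cast
      ring
    rw [this]
    exact Real.rpow_le_rpow (sq_nonneg _) hsq (by positivity)
  have eJ : ∀ J : ℝ, 1 ≤ J → J ^ (-(r * b)) = ((J ^ b) ^ r)⁻¹ := by
    intro J hJ
    rw [Real.rpow_neg (by linarith), mul_comm r b, Real.rpow_mul (by linarith)]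
  rw [eJ _ hj1, eJ _ hj2]
  have eW : japanese ρ ^ α₁ * J₁ ^ b * (japanese s ^ α₂ * J₂ ^ b) =
    (japanese ρ ^ α₁ * japanese s ^ α₂) * (J₁ ^ b * J₂ ^ b) := by ring
  rw [eW, Real.div_rpow (by positivity) (by positivity), Real.mul_rpow (by positivity) (by positivity),
    Real.mul_rpow (x := J₁ ^ b) (by positivity) (by positivity), div_eq_mul_inv, mul_inv, mul_inv,
    ← mul_assoc]
  gcongr

/-- The bound for `weightedSymbol`. -/
def symbolBound (r b : ℝ) : ℝ≥0∞ :=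
  (∫⁻ t, ENNReal.ofReal (japanese t ^ (-(r * b)))) *
    (ENNReal.ofReal (2 * Real.pi) * (2 * (16 * coneKernelBound r)) *
      ∫⁻ t, ENNReal.ofReal (japanese t ^ (-(r * b))))

lemma symbolBound_lt_top {r b : ℝ} (h : 1 < r * b) : symbolBound r b < ∞ := by
  have h1 := lintegral_japanese_lt_top h
  unfold symbolBound
  refine ENNReal.mul_lt_top h1 (ENNReal.mul_lt_top ?_ h1)
  refine ENNReal.mul_lt_top ENNReal.ofReal_lt_top ?_
  exact ENNReal.mul_lt_top (by simp) (ENNReal.mul_lt_top (by simp) ENNReal.coe_lt_top)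

/-- Integrating over `η` first bounds the inner integral uniformly in the remaining variable; the
leftover `∫ φ` then gives the second factor of `symbolBound`. -/
lemma lintegral_weightedSymbol_le {r α₁ α₂ b : ℝ} (hr : 1 < r) (hr2 : r ≤ 2) (hα₁ : 0 ≤ α₁)
    (hα₂ : 0 ≤ α₂) (hα : 2 / r ≤ α₁ + α₂) {ε₁ ε₂ : ℤˣ} {σ : Spacetime → Spacetime → ℝ}
    (hσ : NullSymbol ε₁ ε₂ σ) {p : Spacetime} (hp : spatial p ≠ 0) :
    ∫⁻ p', weightedSymbol α₁ α₂ b ε₁ ε₂ σ p p' ^ r ≤ symbolBound r b := by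
  set φ : ℝ → ℝ≥0∞ := fun t => ENNReal.ofReal (japanese t ^ (-(r * b))) with hφdef
  have hφ : Measurable φ := by
    have := continuous_japanese.measurable
    fun_prop
  have hK := measurable_bipolarKernel r (sgn ε₁ * sgn ε₂) ‖spatial p‖
  set K : EuclideanSpace ℝ (Fin 3) → ℝ≥0∞ := fun η =>
    ENNReal.ofReal (bipolarKernel r (sgn ε₁ * sgn ε₂) ‖spatial p‖ (‖η‖, ‖spatial p - η‖)) with hKdef
  have hKm : Measurable K := by fun_prop
  set Ψ : ℝ × EuclideanSpace ℝ (Fin 3) → ℝ≥0∞ := fun q =>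
    K q.2 * (φ (q.1 + sgn ε₁ * ‖q.2‖) * φ (p 0 - q.1 + sgn ε₂ * ‖spatial p - q.2‖)) with hΨ
  have hΨm : Measurable Ψ := by fun_prop
  calc ∫⁻ p', weightedSymbol α₁ α₂ b ε₁ ε₂ σ p p' ^ r
      ≤ ∫⁻ p' : Spacetime, Ψ (p' 0, spatial p') :=
        lintegral_mono fun p' => weightedSymbol_rpow_le (by linarith) hα₁ hα₂ hα hσ p p'
    _ = ∫⁻ q, Ψ q ∂(volume.prod volume) := measurePreserving_time_spatial.lintegral_comp hΨm
    _ = ∫⁻ η, ∫⁻ t, Ψ (t, η) := lintegral_prod_symm _ hΨm.aemeasurable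
    _ = ∫⁻ η, ∫⁻ t, φ t * (K η *
          φ (p 0 - t + (sgn ε₁ * ‖η‖ + sgn ε₂ * ‖spatial p - η‖))) := by
        refine lintegral_congr fun η => ?_
        -- This shift removes `η` from the first weight and collects both phases in the second, so
        -- the first weight factors out of the `η`-integral.
        rw [← lintegral_add_right_eq_self (fun t => φ t * (K η *
          φ (p 0 - t + (sgn ε₁ * ‖η‖ + sgn ε₂ * ‖spatial p - η‖)))) (sgn ε₁ * ‖η‖)]
        refine lintegral_congr fun t => ?_
        rw [hΨ]
        simp only
        rw [show p 0 - (t + sgn ε₁ * ‖η‖) + (sgn ε₁ * ‖η‖ + sgn ε₂ * ‖spatial p - η‖) =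
          p 0 - t + sgn ε₂ * ‖spatial p - η‖ by ring]
        ring
    _ = ∫⁻ t, ∫⁻ η, φ t * (K η *
          φ (p 0 - t + (sgn ε₁ * ‖η‖ + sgn ε₂ * ‖spatial p - η‖))) :=
        lintegral_lintegral_swap (by fun_prop)
    _ = ∫⁻ t, φ t * ∫⁻ η, (K η *
          φ (p 0 - t + (sgn ε₁ * ‖η‖ + sgn ε₂ * ‖spatial p - η‖))) :=
        lintegral_congr fun t => lintegral_const_mul _ (by fun_prop)
    _ ≤ ∫⁻ t, φ t * (ENNReal.ofReal (2 * Real.pi) * (2 * (16 * coneKernelBound r)) * ∫⁻ t, φ t) := by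
        gcongr with t
        exact lintegral_bipolarKernel_le hr hr2 hp (sgn_eq ε₁) (sgn_eq ε₂) hφ
    _ = symbolBound r b := by
        rw [lintegral_mul_const _ hφ, symbolBound]

/-! ### Hölder's inequality and the estimate on the Fourier side -/

lemma measurable_sub_symbol {σ : Spacetime → Spacetime → ℝ} (hσ : Measurable (Function.uncurry σ))
    (p : Spacetime) : Measurable fun p' => σ p' (p - p') :=
  hσ.comp (measurable_id.prodMk (measurable_const.sub measurable_id))

lemma measurable_bilinearIntegrand {σ : Spacetime → Spacetime → ℝ}
    (hσ : Measurable (Function.uncurry σ)) {f g : Spacetime → ℂ} (hf : Measurable f)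
    (hg : Measurable g) (p : Spacetime) : Measurable (bilinearIntegrand σ f g p) := by
  have := measurable_sub_symbol hσ p
  unfold bilinearIntegrand
  fun_prop

lemma enorm_bilinearIntegrand (α₁ α₂ b : ℝ) (ε₁ ε₂ : ℤˣ) (σ : Spacetime → Spacetime → ℝ)
    (f g : Spacetime → ℂ) (p p' : Spacetime) :
    ‖bilinearIntegrand σ f g p p'‖ₑ = weightedSymbol α₁ α₂ b ε₁ ε₂ σ p p' *
      (‖(xWeight α₁ b ε₁ p' : ℂ) * f p'‖ₑ * ‖(xWeight α₂ b ε₂ (p - p') : ℂ) * g (p - p')‖ₑ) := by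
  have h1 := xWeight_pos α₁ b ε₁ p'
  have h2 := xWeight_pos α₂ b ε₂ (p - p')
  rw [bilinearIntegrand, weightedSymbol, ← enorm_mul, ← ofReal_norm, ← ofReal_norm,
    ← ENNReal.ofReal_mul (by positivity)]
  congr 1
  simp only [norm_mul, Complex.norm_real, Real.norm_eq_abs, abs_of_pos h1, abs_of_pos h2]
  field_simp

/-- Hölder in `p'` puts the weighted symbol in `L^r`, where it is bounded uniformly in `p`, and the
product of the weighted inputs in `L^{r'}`. -/
lemma lintegral_enorm_bilinearIntegrand_le {r α₁ α₂ b : ℝ} (hr : 1 < r) (hr2 : r ≤ 2)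
    (hα₁ : 0 ≤ α₁) (hα₂ : 0 ≤ α₂) (hα : 2 / r ≤ α₁ + α₂) {ε₁ ε₂ : ℤˣ}
    {σ : Spacetime → Spacetime → ℝ} (hσ : NullSymbol ε₁ ε₂ σ) {f g : Spacetime → ℂ}
    (hf : Measurable f) (hg : Measurable g) {p : Spacetime} (hp : spatial p ≠ 0) :
    ∫⁻ p', ‖bilinearIntegrand σ f g p p'‖ₑ ≤ symbolBound r b ^ (1 / r) *
      (∫⁻ p', ‖(xWeight α₁ b ε₁ p' : ℂ) * f p'‖ₑ ^ (r / (r - 1)) *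
        ‖(xWeight α₂ b ε₂ (p - p') : ℂ) * g (p - p')‖ₑ ^ (r / (r - 1))) ^ (1 / (r / (r - 1))) := by
  have hpq : r.HolderConjugate (r / (r - 1)) := Real.HolderConjugate.conjExponent hr
  have hw1 := measurable_xWeight α₁ b ε₁
  have hw2 := measurable_xWeight α₂ b ε₂
  have hs := measurable_sub_symbol hσ.measurable p
  have hk : Measurable (weightedSymbol α₁ α₂ b ε₁ ε₂ σ p) := by
    have : Measurable fun p' => |σ p' (p - p')| := hs.norm
    unfold weightedSymbol
    fun_prop
  simp only [enorm_bilinearIntegrand α₁ α₂ b ε₁ ε₂]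
  refine (ENNReal.lintegral_mul_le_Lp_mul_Lq volume hpq hk.aemeasurable
    (g := fun p' => ‖(xWeight α₁ b ε₁ p' : ℂ) * f p'‖ₑ *
      ‖(xWeight α₂ b ε₂ (p - p') : ℂ) * g (p - p')‖ₑ) (by fun_prop)).trans ?_
  simp only [ENNReal.mul_rpow_of_nonneg _ _ hpq.symm.nonneg]
  gcongr
  exact lintegral_weightedSymbol_le hr hr2 hα₁ hα₂ hα hσ hp

lemma lintegral_lintegral_mul_sub {F G : Spacetime → ℝ≥0∞} (hF : Measurable F)
    (hG : Measurable G) :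
    ∫⁻ p, ∫⁻ p', F p' * G (p - p') = (∫⁻ p, F p) * ∫⁻ p, G p := by
  rw [lintegral_lintegral_swap (by fun_prop)]
  have : ∀ p' : Spacetime, ∫⁻ p, F p' * G (p - p') = F p' * ∫⁻ p, G p := fun p' => by
    rw [lintegral_const_mul _ (by fun_prop), lintegral_sub_right_eq_self]
  simp only [this]
  rw [lintegral_mul_const _ hF]

lemma eLpNorm_dualExponent {r : ℝ} (hr : 1 < r) (F : Spacetime → ℂ) :
    eLpNorm F (dualExponent r) volume =
      (∫⁻ p, ‖F p‖ₑ ^ (r / (r - 1))) ^ (1 / (r / (r - 1))) := by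
  have hq : 0 < r / (r - 1) := div_pos (by linarith) (by linarith)
  rw [dualExponent, eLpNorm_eq_lintegral_rpow_enorm_toReal (by simpa using hq)
    ENNReal.ofReal_ne_top, ENNReal.toReal_ofReal hq.le]

lemma xNormHat_eq {r : ℝ} (hr : 1 < r) (s b : ℝ) (ε : ℤˣ) (F : Spacetime → ℂ) :
    xNormHat r s b ε F =
      (∫⁻ p, ‖(xWeight s b ε p : ℂ) * F p‖ₑ ^ (r / (r - 1))) ^ (1 / (r / (r - 1))) :=
  eLpNorm_dualExponent hr _

lemma hNormHat_zero_zero {r : ℝ} (hr : 1 < r) (F : Spacetime → ℂ) :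
    hNormHat r 0 0 F = (∫⁻ p, ‖F p‖ₑ ^ (r / (r - 1))) ^ (1 / (r / (r - 1))) := by
  rw [← eLpNorm_dualExponent hr, hNormHat]
  simp

lemma xNormHat_congr_ae {r s b : ℝ} {ε : ℤˣ} {f g : Spacetime → ℂ} (h : f =ᵐ[volume] g) :
    xNormHat r s b ε f = xNormHat r s b ε g := by
  refine eLpNorm_congr_ae ?_
  filter_upwards [h] with p hp
  rw [hp]

lemma bilinearIntegrand_congr_ae (σ : Spacetime → Spacetime → ℝ) {f f' g g' : Spacetime → ℂ}
    (hf : f =ᵐ[volume] f') (hg : g =ᵐ[volume] g') (p : Spacetime) :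
    bilinearIntegrand σ f g p =ᵐ[volume] bilinearIntegrand σ f' g' p := by
  filter_upwards [hf, (Measure.measurePreserving_sub_left volume p).quasiMeasurePreserving.ae_eq_comp hg]
    with p' h1 h2
  simp only [Function.comp_apply] at h2
  rw [bilinearIntegrand, bilinearIntegrand, h1, h2]

lemma enorm_bilinearHat_le (σ : Spacetime → Spacetime → ℝ) (f g : Spacetime → ℂ) (p : Spacetime) :
    ‖bilinearHat σ f g p‖ₑ ≤ ∫⁻ p', ‖bilinearIntegrand σ f g p p'‖ₑ := by
  rw [bilinearHat, enorm_mul]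
  refine le_trans ?_ (enorm_integral_le_lintegral_enorm _)
  refine mul_le_of_le_one_left zero_le ?_
  rw [← ofReal_norm, ENNReal.ofReal_le_one, norm_inv, Complex.norm_real,
    Real.norm_of_nonneg (by positivity)]
  -- The normalisation `(2π)⁻⁴` is at most `1` and is discarded.
  refine inv_le_one_of_one_le₀ (one_le_pow₀ ?_)
  linarith [Real.pi_gt_three]

lemma lintegral_bilinearIntegrand_rpow_le {r α₁ α₂ b : ℝ} (hr : 1 < r) (hr2 : r ≤ 2)
    (hα₁ : 0 ≤ α₁) (hα₂ : 0 ≤ α₂) (hα : 2 / r ≤ α₁ + α₂) {ε₁ ε₂ : ℤˣ}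
    {σ : Spacetime → Spacetime → ℝ} (hσ : NullSymbol ε₁ ε₂ σ) {f g : Spacetime → ℂ}
    (hf : Measurable f) (hg : Measurable g) :
    (∫⁻ p, (∫⁻ p', ‖bilinearIntegrand σ f g p p'‖ₑ) ^ (r / (r - 1))) ^ (1 / (r / (r - 1))) ≤
      symbolBound r b ^ (1 / r) * xNormHat r α₁ b ε₁ f * xNormHat r α₂ b ε₂ g := by
  have hw1 := measurable_xWeight α₁ b ε₁
  have hw2 := measurable_xWeight α₂ b ε₂
  have hq : 0 < r / (r - 1) := div_pos (by linarith) (by linarith)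
  set q := r / (r - 1) with hqdef
  set F : Spacetime → ℝ≥0∞ := fun p => ‖(xWeight α₁ b ε₁ p : ℂ) * f p‖ₑ ^ q with hF
  set G : Spacetime → ℝ≥0∞ := fun p => ‖(xWeight α₂ b ε₂ p : ℂ) * g p‖ₑ ^ q with hG
  have hFm : Measurable F := by fun_prop
  have hGm : Measurable G := by fun_prop
  have hle : ∀ᵐ p : Spacetime, (∫⁻ p', ‖bilinearIntegrand σ f g p p'‖ₑ) ^ q ≤
      (symbolBound r b ^ (1 / r)) ^ q * ∫⁻ p', F p' * G (p - p') := by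
    -- Bipolar coordinates need `ξ ≠ 0`, which fails only on a null set.
    filter_upwards [ae_spatial_ne_zero] with p hp
    have h := lintegral_enorm_bilinearIntegrand_le (b := b) hr hr2 hα₁ hα₂ hα hσ hf hg hp
    refine (ENNReal.rpow_le_rpow h hq.le).trans_eq ?_
    rw [ENNReal.mul_rpow_of_nonneg _ _ hq.le, ← hqdef, ← ENNReal.rpow_mul (lintegral _ _),
      one_div_mul_cancel hq.ne', ENNReal.rpow_one]
  refine (ENNReal.rpow_le_rpow (lintegral_mono_ae hle) (by positivity)).trans_eq ?_
  have hm : Measurable fun p => ∫⁻ p', F p' * G (p - p') :=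
    Measurable.lintegral_prod_right' (f := fun z : Spacetime × Spacetime => F z.2 * G (z.1 - z.2))
      (by fun_prop)
  rw [lintegral_const_mul _ hm, lintegral_lintegral_mul_sub hFm hGm,
    ENNReal.mul_rpow_of_nonneg _ _ (by positivity), ENNReal.mul_rpow_of_nonneg _ _ (by positivity),
    ← ENNReal.rpow_mul, mul_one_div_cancel hq.ne', ENNReal.rpow_one, xNormHat_eq hr, xNormHat_eq hr,
    mul_assoc]

/-- The constant of the null form estimates. -/
def nullFormConst (r b : ℝ) : ℝ≥0 := (symbolBound r b ^ (1 / r)).toNNReal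

lemma coe_nullFormConst {r b : ℝ} (hr : 1 < r) (hb : 1 / r < b) :
    (nullFormConst r b : ℝ≥0∞) = symbolBound r b ^ (1 / r) := by
  have h : 1 < r * b := by
    rw [div_lt_iff₀ (by linarith)] at hb
    linarith
  exact ENNReal.coe_toNNReal (ENNReal.rpow_lt_top_of_nonneg (by positivity)
    (symbolBound_lt_top h).ne).ne

/-- The bound is proved for the integral of the absolute value of the integrand, so finite input
norms also give absolute convergence for almost every `p`. Measurable representatives change the
integrand only on a null set for each `p`. -/
lemma bilinear_null_estimate {r α₁ α₂ b : ℝ} (hr : 1 < r) (hr2 : r ≤ 2)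
    (hα₁ : 0 ≤ α₁) (hα₂ : 0 ≤ α₂) (hα : 2 / r ≤ α₁ + α₂) (hb : 1 / r < b) {ε₁ ε₂ : ℤˣ}
    {σ : Spacetime → Spacetime → ℝ} (hσ : NullSymbol ε₁ ε₂ σ) {f g : Spacetime → ℂ}
    (hf : AEStronglyMeasurable f volume) (hg : AEStronglyMeasurable g volume) :
    (xNormHat r α₁ b ε₁ f < ∞ → xNormHat r α₂ b ε₂ g < ∞ →
      ∀ᵐ p ∂(volume : Measure Spacetime), Integrable (bilinearIntegrand σ f g p) volume) ∧
    hNormHat r 0 0 (bilinearHat σ f g) ≤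
      nullFormConst r b * xNormHat r α₁ b ε₁ f * xNormHat r α₂ b ε₂ g := by
  have hq : 0 < r / (r - 1) := div_pos (by linarith) (by linarith)
  have hfm := hf.stronglyMeasurable_mk.measurable
  have hgm := hg.stronglyMeasurable_mk.measurable
  have hae := bilinearIntegrand_congr_ae σ hf.ae_eq_mk hg.ae_eq_mk
  have key := lintegral_bilinearIntegrand_rpow_le (b := b) hr hr2 hα₁ hα₂ hα hσ hfm hgm
  rw [← xNormHat_congr_ae hf.ae_eq_mk, ← xNormHat_congr_ae hg.ae_eq_mk,
    ← coe_nullFormConst hr hb] at key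
  constructor
  · intro h1 h2
    have hlt := key.trans_lt (ENNReal.mul_lt_top (ENNReal.mul_lt_top ENNReal.coe_lt_top h1) h2)
    have hlt' : ∫⁻ p, (∫⁻ p', ‖bilinearIntegrand σ (hf.mk f) (hg.mk g) p p'‖ₑ) ^ (r / (r - 1)) ≠ ∞ := by
      intro h
      rw [h, ENNReal.top_rpow_of_pos (by positivity)] at hlt
      exact lt_irrefl _ hlt
    have hm : Measurable fun p =>
        (∫⁻ p', ‖bilinearIntegrand σ (hf.mk f) (hg.mk g) p p'‖ₑ) ^ (r / (r - 1)) := by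
      refine Measurable.pow_const (Measurable.lintegral_prod_right'
        (f := fun z : Spacetime × Spacetime =>
          ‖bilinearIntegrand σ (hf.mk f) (hg.mk g) z.1 z.2‖ₑ) ?_) _
      have : Measurable fun z : Spacetime × Spacetime => σ z.2 (z.1 - z.2) :=
        hσ.measurable.comp (measurable_snd.prodMk (measurable_fst.sub measurable_snd))
      exact (((Complex.measurable_ofReal.comp this).mul (hfm.comp measurable_snd)).mul
        (hgm.comp (measurable_fst.sub measurable_snd))).enorm
    filter_upwards [ae_lt_top hm hlt'] with p hp
    rw [integrable_congr (hae p)]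
    refine ⟨(measurable_bilinearIntegrand hσ.measurable hfm hgm p).aestronglyMeasurable, ?_⟩
    exact (ENNReal.rpow_lt_top_iff_of_pos hq).1 hp
  · refine le_trans ?_ key
    rw [hNormHat_zero_zero hr]
    gcongr with p
    have : bilinearHat σ f g p = bilinearHat σ (hf.mk f) (hg.mk g) p := by
      rw [bilinearHat, bilinearHat, integral_congr_ae (hae p)]
    rw [this]
    exact enorm_bilinearHat_le _ _ _ p

lemma nullFormEstimate_of_nullSymbol {r α₁ α₂ b : ℝ} (hr : 1 < r) (hr2 : r ≤ 2)
    (hα₁ : 0 ≤ α₁) (hα₂ : 0 ≤ α₂) (hα : 2 / r ≤ α₁ + α₂) (hb : 1 / r < b) {ε₁ ε₂ : ℤˣ}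
    {σ : Spacetime → Spacetime → ℝ} (hσ : NullSymbol ε₁ ε₂ σ)
    {q : (Spacetime → ℂ) → (Spacetime → ℂ) → Spacetime → ℂ}
    (hq : ∀ u v : 𝓢(Spacetime, ℂ), Integrable (q u v) ∧ angularFourier (q u v) =ᵐ[volume]
      bilinearHat σ (angularFourier u) (angularFourier v)) :
    NullFormEstimate r α₁ α₂ b ε₁ ε₂ (nullFormConst r b) q σ := by
  refine ⟨fun u v => ⟨(hq u v).1, ?_, (hq u v).2⟩, fun f g hf hg h1 h2 => ?_⟩
  · have hc : ∀ w : 𝓢(Spacetime, ℂ), AEStronglyMeasurable (angularFourier w) volume := fun w =>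
      ((continuous_fourier w.integrable).comp (continuous_const_smul _)).aestronglyMeasurable
    have h : hNorm r 0 0 (q u v) = hNormHat r 0 0
        (bilinearHat σ (angularFourier u) (angularFourier v)) := by
      refine eLpNorm_congr_ae ?_
      filter_upwards [(hq u v).2] with p hp
      rw [hp]
    rw [h]
    exact (bilinear_null_estimate hr hr2 hα₁ hα₂ hα hb hσ (hc u) (hc v)).2
  · have h := bilinear_null_estimate hr hr2 hα₁ hα₂ hα hb hσ hf hg
    exact ⟨h.1 h1 h2, h.2⟩

end

theorem lemma5p1 (r α₁ α₂ b : ℝ) (hr : 1 < r) (hr2 : r ≤ 2) (hα₁ : 0 ≤ α₁) (hα₂ : 0 ≤ α₂)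
    (hα : 2 / r ≤ α₁ + α₂) (hb : 1 / r < b) :
    ∃ C : ℝ≥0, ∀ ε₁ ε₂ : ℤˣ,
      (∀ i j : Fin 3, NullFormEstimate r α₁ α₂ b ε₁ ε₂ C (qij i j) (symbolQij i j)) ∧
      (∀ j : Fin 3,
        NullFormEstimate r α₁ α₂ b ε₁ ε₂ C (q0j ε₁ ε₂ j) (symbolQ0j ε₁ ε₂ j)) ∧
      NullFormEstimate r α₁ α₂ b ε₁ ε₂ C (q0 ε₁ ε₂) (symbolQ0 ε₁ ε₂) :=
  ⟨nullFormConst r b, fun ε₁ ε₂ =>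
    ⟨fun i j => nullFormEstimate_of_nullSymbol hr hr2 hα₁ hα₂ hα hb
        (nullSymbol_symbolQij ε₁ ε₂ i j) (qij_schwartz i j),
      fun j => nullFormEstimate_of_nullSymbol hr hr2 hα₁ hα₂ hα hb
        (nullSymbol_symbolQ0j ε₁ ε₂ j) (q0j_schwartz ε₁ ε₂ j),
      nullFormEstimate_of_nullSymbol hr hr2 hα₁ hα₂ hα hb
        (nullSymbol_symbolQ0 ε₁ ε₂) (q0_schwartz ε₁ ε₂)⟩⟩
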